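/- Let $A$ be a finite alphabet, let $A^+$ be the free semigroup on $A$, and let $\overline{\Omega}_A\mathsf S$ be the free profinite semigroup on $A$, in which $A^+$ is embedded. Let $\varphi$ be a substitution over $A$, that is, an endomorphism of $A^+$; its continuous extension to $\overline{\Omega}_A\mathsf S$ is also denoted $\varphi$, and $\varphi^\omega=\lim_n\varphi^{n!}$ (pointwise) is the idempotent iterate. Assume: (i) $\varphi$ is weakly primitive: for some $n\ge 1$ all words $\varphi^n(c)$ ($c\in A$) have length at least two and the same factors of length two. Denote by $L$ the set of all words that are factors of $\varphi^k(c)$ for every $c\in A$ and all sufficiently large $k$ (the language of the minimal subshift of $\varphi$), and put $J(\varphi)=\overline{L}\setminus L$, with the closure taken in $\overline{\Omega}_A\mathsf S$. (ii) There are letters $a,b\in A$ such that every $\varphi(c)$ ($c\in A$) starts with $a$ and ends with $b$. (iii) $\varphi$ is an encoding of bounded delay with respect to the factors of $J(\varphi)$: it is injective on $A^+$, and, with $C=\varphi(A)$ and $F$ the set of the words in $A^+$ that are factors of elements of $J(\varphi)$, there is an integer $N$ such that every equality of one of the forms $uc_1\cdots c_mv=c_1'\cdots c_n'$ or $uc_1\cdots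 c_m=c_1'\cdots c_n'v$, with both sides equal to a word of $F$, with $c_i,c_j'\in C$, $u$ a nonempty suffix and $v$ a nonempty prefix of words of $C$, and with $m+n>N$, is reducible. Here an equality $u_1\cdots u_p=v_1\cdots v_q$ of products of nonempty words is reducible if $u_r\cdots u_p=v_s\cdots v_q$ for some $1\le r\le p$, $1\le s\le q$ with $2<r+s\le p+q$. Let $G(\varphi)$ be the intersection of the $\mathcal R$-class of $\varphi^\omega(a)$ with the $\mathcal L$-class of $\varphi^\omega(b)$ in $\overline{\Omega}_A\mathsf S$. Let $R(ba)$ be the set of return words of $ba$, that is, of the nonempty words $v$ such that $vba\in L$, $ba$ is a prefix of $vba$, and $ba$ occurs in $vba$ only as a prefix and as a suffix, and let $X=b^{-1}R(ba)b=\{x\in A^+: bx\in R(ba)\,b\}$. Then $X$ is finite, and there is a unique endomorphism $\varphi_X$ of the free semigroup $X^+$ that is compatible with $\varphi$ under the homomorphism $X^+\to A^+$ that sends each generator $x\in X$ to the word $x$. Let $\varphi_{X,\mathsf G}$ be the continuous endomorphism of the free profinite group $\overline{\Omega}_X\mathsf G$ on $X$ that sends each generator $x$ to $\varphi_X(x)$,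 read as a group word, and let $\varphi_{X,\mathsf G}^\omega=\lim_n\varphi_{X,\mathsf G}^{\,n!}$. Then $$\langle X\mid \varphi_{X,\mathsf G}^{\omega}(x)=x\ (x\in X)\rangle$$ is a presentation of $G(\varphi)$ as a profinite group: there is an isomorphism, algebraic and topological, from the quotient of $\overline{\Omega}_X\mathsf G$ by the closed normal subgroup generated by the elements $\varphi_{X,\mathsf G}^{\omega}(x)\,x^{-1}$ ($x\in X$) onto $G(\varphi)$, which maps the class of each $x\in X$ to $\varphi^\omega(x)$. -/

import Mathlib

open Filter Topology

universe u

/-! ### Factors and Green's relations in a semigroup -/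

section Semigroup

variable {S : Type*} [Semigroup S]

/-- `s` is a prefix (left divisor) of `t`, that is, `t ∈ s S¹`. -/
def IsPrefixOf (s t : S) : Prop := ∃ y : WithOne S, (t : WithOne S) = (s : WithOne S) * y

/-- `s` is a suffix (right divisor) of `t`, that is, `t ∈ S¹ s`. -/
def IsSuffixOf (s t : S) : Prop := ∃ x : WithOne S, (t : WithOne S) = x * (s : WithOne S)

/-- `s` is a factor of `t`, that is, `t ∈ S¹ s S¹`. -/
def IsFactorOf (s t : S) : Prop :=
  ∃ x y : WithOne S, (t : WithOne S) = x * (s : WithOne S) * y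

/-- Green's relation `R`: the two elements generate the same principal right ideal. -/
def GreenR (s t : S) : Prop := IsPrefixOf s t ∧ IsPrefixOf t s

/-- Green's relation `L`: the two elements generate the same principal left ideal. -/
def GreenL (s t : S) : Prop := IsSuffixOf s t ∧ IsSuffixOf t s

end Semigroup

/-! ### The `ω`-power of a self-map -/

/-- The `ω`-power of a self-map `f`: the pointwise limit of the iterates `f^{n!}`.
For the continuous endomorphisms considered below this limit exists
(`FreeProfiniteSemigroup.tendsto_omegaPow_map`, `FreeProfiniteGroup.tendsto_omegaPow_map`),
and it is the idempotent in the closed subsemigroup generated by `f`. -/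
noncomputable def omegaPow {S : Type*} [TopologicalSpace S] (f : S → S) (x : S) : S :=
  @limUnder S _ ℕ ⟨x⟩ atTop fun n : ℕ => f^[n.factorial] x

theorem tendsto_omegaPow {S : Type*} [TopologicalSpace S] {f : S → S} {x l : S}
    (h : Tendsto (fun n : ℕ => f^[n.factorial] x) atTop (𝓝 l)) :
    Tendsto (fun n : ℕ => f^[n.factorial] x) atTop (𝓝 (omegaPow f x)) :=
  tendsto_nhds_limUnder ⟨l, h⟩

theorem iterate_factorial_eventually_const {T : Type*} [Finite T] (g : T → T) (t : T) :
    ∃ N : ℕ, ∀ n, N ≤ n → g^[n.factorial] t = g^[N.factorial] t := by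
  obtain ⟨i, j, hij, h⟩ : ∃ i j : ℕ, i < j ∧ g^[i] t = g^[j] t := by
    obtain ⟨i, j, hne, h⟩ := Finite.exists_ne_map_eq_of_infinite fun n : ℕ => g^[n] t
    rcases lt_or_gt_of_ne hne with hlt | hlt
    · exact ⟨i, j, hlt, h⟩
    · exact ⟨j, i, hlt, h.symm⟩
  refine ⟨j, fun n hn => ?_⟩
  have hp : Function.IsPeriodicPt g (j - i) (g^[i] t) := by
    show g^[j - i] (g^[i] t) = g^[i] t
    rw [← Function.iterate_add_apply, Nat.sub_add_cancel hij.le, h]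
  have hd : (j - i) ∣ n.factorial - j.factorial :=
    Nat.dvd_sub (Nat.dvd_factorial (by omega) (by omega))
      (Nat.dvd_factorial (by omega) (by omega))
  have hle : j.factorial ≤ n.factorial := Nat.factorial_le hn
  have hi : i ≤ j.factorial := hij.le.trans (Nat.self_le_factorial j)
  have hq : g^[n.factorial - j.factorial] (g^[i] t) = g^[i] t := hp.trans_dvd hd
  calc g^[n.factorial] t = g^[(j.factorial - i) + ((n.factorial - j.factorial) + i)] t := by congr 2; omega
    _ = g^[j.factorial - i] (g^[i] t) := by
      rw [Function.iterate_add_apply, Function.iterate_add_apply g (n.factorial - j.factorial) i, hq]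
    _ = g^[j.factorial] t := by rw [← Function.iterate_add_apply, Nat.sub_add_cancel hi]

/-! ### The free profinite semigroup -/

/-- The congruences of finite index on the free semigroup `A⁺`. -/
abbrev FiniteIndexCon (A : Type u) : Type u :=
  {c : Con (FreeSemigroup A) // Finite c.Quotient}

/-- The free profinite semigroup on a finite set `A`: the projective limit of the finite
quotients of the free semigroup `A⁺`. -/
structure FreeProfiniteSemigroup (A : Type u) : Type u where
  /-- The image in each finite quotient. -/
  val : (c : FiniteIndexCon A) → c.1.Quotient
  /-- The images are compatible with the projections between the finite quotients. -/
  compat : ∀ c d : FiniteIndexCon A, c.1 ≤ d.1 → ∀ w : FreeSemigroup A,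
    val c = (w : c.1.Quotient) → val d = (w : d.1.Quotient)

namespace FreeProfiniteSemigroup

variable {A B : Type u}

@[ext] theorem ext {x y : FreeProfiniteSemigroup A} (h : ∀ c, x.1 c = y.1 c) : x = y := by
  cases x; cases y; congr 1; exact funext h

theorem exists_rep (x : FreeProfiniteSemigroup A) (c : FiniteIndexCon A) :
    ∃ w : FreeSemigroup A, x.1 c = (w : c.1.Quotient) := by
  obtain ⟨w, hw⟩ := Quotient.exists_rep (x.1 c)
  exact ⟨w, hw.symm⟩

/-- The topology of the projective limit of discrete spaces. -/
instance : TopologicalSpace (FreeProfiniteSemigroup A) :=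
  TopologicalSpace.induced (fun x c => x.1 c) (@Pi.topologicalSpace _ _ fun _ => ⊥)

instance : Mul (FreeProfiniteSemigroup A) where
  mul x y := ⟨fun c => x.1 c * y.1 c, by
    intro c d h w hw
    obtain ⟨p, hp⟩ := x.exists_rep c
    obtain ⟨q, hq⟩ := y.exists_rep c
    have hw' : ((p * q : FreeSemigroup A) : c.1.Quotient) = w := by
      rw [Con.coe_mul, ← hp, ← hq]; exact hw
    show x.1 d * y.1 d = w
    rw [x.2 c d h p hp, y.2 c d h q hq, ← Con.coe_mul]
    exact (Con.eq _).2 (h ((Con.eq _).1 hw'))⟩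

theorem mul_apply (x y : FreeProfiniteSemigroup A) (c : FiniteIndexCon A) :
    (x * y).1 c = x.1 c * y.1 c := rfl

instance : Semigroup (FreeProfiniteSemigroup A) where
  mul_assoc x y z := by ext c; simp only [mul_apply]; exact mul_assoc _ _ _

/-- The canonical embedding of the free semigroup in the free profinite semigroup. -/
def ofWord : FreeSemigroup A →ₙ* FreeProfiniteSemigroup A where
  toFun w := ⟨fun _ => w, fun _ _ h _ hv => (Con.eq _).2 (h ((Con.eq _).1 hv))⟩
  map_mul' _ _ := rfl

/-- The pull-back of a congruence of finite index under a homomorphism. -/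
def comapCon (f : FreeSemigroup A →ₙ* FreeSemigroup B) (c : FiniteIndexCon B) :
    FiniteIndexCon A :=
  ⟨c.1.comap f (map_mul f), by
    have := c.2
    refine Finite.of_injective
      (fun q : (c.1.comap f (map_mul f)).Quotient =>
        Con.liftOn q (fun w => (f w : c.1.Quotient)) fun v w h => (Con.eq _).2 h) ?_
    intro p q
    induction p using Con.induction_on
    induction q using Con.induction_on
    intro h
    exact (Con.eq _).2 ((Con.eq c.1).1 h)⟩

/-- The continuous homomorphism of free profinite semigroups that extends a homomorphism `f` of
free semigroups. -/
def map (f : FreeSemigroup A →ₙ* FreeSemigroup B) :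
    FreeProfiniteSemigroup A →ₙ* FreeProfiniteSemigroup B where
  toFun x := ⟨fun c => Con.liftOn (x.1 (comapCon f c)) (fun w => (f w : c.1.Quotient))
      fun v w h => (Con.eq _).2 h, by
    intro c d h w hw
    obtain ⟨p, hp⟩ := x.exists_rep (comapCon f c)
    have hp' := x.2 (comapCon f c) (comapCon f d) (fun {_ _} h' => h h') p hp
    simp only [hp, hp', Con.liftOn_coe] at hw ⊢
    exact (Con.eq _).2 (h ((Con.eq _).1 hw))⟩
  map_mul' x y := by
    ext c
    obtain ⟨p, hp⟩ := x.exists_rep (comapCon f c)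
    obtain ⟨q, hq⟩ := y.exists_rep (comapCon f c)
    have hpq : (x * y).1 (comapCon f c) = ((p * q : FreeSemigroup A) : _) := by
      rw [mul_apply, hp, hq, Con.coe_mul]
    rw [mul_apply]
    simp only [hp, hq, hpq, Con.liftOn_coe]
    rw [map_mul, Con.coe_mul]

theorem map_apply_of_rep (f : FreeSemigroup A →ₙ* FreeSemigroup B)
    (x : FreeProfiniteSemigroup A) (c : FiniteIndexCon B) (w : FreeSemigroup A)
    (h : x.1 (comapCon f c) = w) : (map f x).1 c = (f w : c.1.Quotient) := by
  show Con.liftOn (x.1 (comapCon f c)) _ _ = _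
  rw [h, Con.liftOn_coe]

theorem map_ofWord (f : FreeSemigroup A →ₙ* FreeSemigroup B) (w : FreeSemigroup A) :
    map f (ofWord w) = ofWord (f w) := rfl

theorem continuous_map (f : FreeSemigroup A →ₙ* FreeSemigroup B) : Continuous (map f) := by
  let : ∀ c : FiniteIndexCon A, TopologicalSpace c.1.Quotient := fun _ => ⊥
  let : ∀ c : FiniteIndexCon B, TopologicalSpace c.1.Quotient := fun _ => ⊥
  have : ∀ c : FiniteIndexCon A, DiscreteTopology c.1.Quotient := fun _ => ⟨rfl⟩
  refine continuous_induced_rng.2 (continuous_pi fun c => ?_)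
  have h1 : Continuous fun x : FreeProfiniteSemigroup A => x.1 (comapCon f c) :=
    (continuous_apply (comapCon f c)).comp continuous_induced_dom
  exact (continuous_of_discreteTopology (f := fun q : (comapCon f c).1.Quotient =>
    Con.liftOn q (fun w => (f w : c.1.Quotient)) fun v w h => (Con.eq _).2 h)).comp h1

/-- The `ω`-power of an endomorphism of the free profinite semigroup on a finite set that comes
from a substitution is a genuine limit. -/
theorem tendsto_omegaPow_map [Finite A] (f : FreeSemigroup A →ₙ* FreeSemigroup A)
    (x : FreeProfiniteSemigroup A) :
    Tendsto (fun n : ℕ => (map f)^[n.factorial] x) atTop (𝓝 (omegaPow (map f) x)) := by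
  have key : ∀ c : FiniteIndexCon A, ∃ N : ℕ, ∀ n, N ≤ n →
      ((map f)^[n.factorial] x).1 c = ((map f)^[N.factorial] x).1 c := by
    intro c
    have := c.2
    let g : (A → c.1.Quotient) → (A → c.1.Quotient) :=
      fun h a => FreeSemigroup.lift h (f (FreeSemigroup.of a))
    let h0 : A → c.1.Quotient := fun a => (FreeSemigroup.of a : FreeSemigroup A)
    have hl : ∀ h, FreeSemigroup.lift (g h) = (FreeSemigroup.lift h).comp f := by
      intro h; apply FreeSemigroup.hom_ext; funext a; simp [g]
    have h0w : ∀ w : FreeSemigroup A, FreeSemigroup.lift h0 w = (w : c.1.Quotient) := by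
      intro w
      induction w using FreeSemigroup.recOnMul with
      | ih1 a => rfl
      | ih2 a y ha hy => rw [map_mul, ha, hy, Con.coe_mul]
    have hk : ∀ (k : ℕ) (w : FreeSemigroup A),
        FreeSemigroup.lift (g^[k] h0) w = ((f^[k] w : FreeSemigroup A) : c.1.Quotient) := by
      intro k
      induction k with
      | zero => intro w; simpa using h0w w
      | succ k ih =>
        intro w
        rw [Function.iterate_succ_apply', hl, MulHom.comp_apply, ih,
          ← Function.iterate_succ_apply]
    -- the `k`-th iterate at `c` only depends on `f^[k]` modulo `c`
    have hx : ∀ k : ℕ, ∃ d : FiniteIndexCon A, ∀ e : FiniteIndexCon A, e.1 ≤ d.1 →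
        ∀ w : FreeSemigroup A, x.1 e = w →
          ((map f)^[k] x).1 c = ((f^[k] w : FreeSemigroup A) : c.1.Quotient) := by
      intro k
      have : ∀ (k : ℕ) (c : FiniteIndexCon A), ∃ d : FiniteIndexCon A,
          ∀ e : FiniteIndexCon A, e.1 ≤ d.1 → ∀ w : FreeSemigroup A, x.1 e = w →
            ((map f)^[k] x).1 c = ((f^[k] w : FreeSemigroup A) : c.1.Quotient) := by
        intro k
        induction k with
        | zero => exact fun c => ⟨c, fun e he w hw => x.2 e c he w hw⟩
        | succ k ih =>
          intro c
          obtain ⟨d, hd⟩ := ih (comapCon f c)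
          refine ⟨d, fun e he w hw => ?_⟩
          rw [Function.iterate_succ_apply', Function.iterate_succ_apply']
          exact map_apply_of_rep f _ c _ (hd e he w hw)
      exact this k c
    obtain ⟨N, hN⟩ := iterate_factorial_eventually_const g h0
    refine ⟨N, fun n hn => ?_⟩
    obtain ⟨d, hd⟩ := hx (n.factorial)
    obtain ⟨d', hd'⟩ := hx (N.factorial)
    let e : FiniteIndexCon A := ⟨d.1 ⊓ d'.1, by
      have := d.2
      have := d'.2
      refine Finite.of_injective
        (fun q : (d.1 ⊓ d'.1).Quotient =>
          (Con.liftOn q (fun w => ((w : d.1.Quotient), (w : d'.1.Quotient)))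
            fun v w h => Prod.ext ((Con.eq _).2 h.1) ((Con.eq _).2 h.2) :
              d.1.Quotient × d'.1.Quotient)) ?_
      intro p q
      induction p using Con.induction_on
      induction q using Con.induction_on
      intro h
      exact (Con.eq _).2 ⟨(Con.eq _).1 (congrArg Prod.fst h), (Con.eq _).1 (congrArg Prod.snd h)⟩⟩
    obtain ⟨w, hw⟩ := x.exists_rep e
    rw [hd e inf_le_left w hw, hd' e inf_le_right w hw, ← hk, ← hk, hN n hn]
  choose N hN using key
  let l : FreeProfiniteSemigroup A := ⟨fun c => ((map f)^[(N c).factorial] x).1 c, by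
    intro c d h w hw
    rw [← hN c (max (N c) (N d)) (le_max_left _ _)] at hw
    rw [← hN d (max (N c) (N d)) (le_max_right _ _)]
    exact ((map f)^[(max (N c) (N d)).factorial] x).2 c d h w hw⟩
  refine tendsto_omegaPow (l := l) ?_
  let : ∀ c : FiniteIndexCon A, TopologicalSpace c.1.Quotient := fun _ => ⊥
  rw [nhds_induced, tendsto_comap_iff, tendsto_pi_nhds]
  intro c
  exact tendsto_const_nhds.congr' (eventually_atTop.2 ⟨N c, fun n hn => (hN c n hn).symm⟩)

end FreeProfiniteSemigroup

/-! ### The free profinite group and profinite presentations -/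

/-- The free profinite group on a finite set `X`: the profinite completion of the free group. -/
noncomputable abbrev FreeProfiniteGroup (X : Type u) : ProfiniteGrp.{u} :=
  ProfiniteGrp.profiniteCompletion.obj (GrpCat.of (FreeGroup X))

namespace FreeProfiniteGroup

variable {X : Type u}

/-- The free generators of the free profinite group. -/
noncomputable def gen (x : X) : FreeProfiniteGroup X :=
  ProfiniteGrp.ProfiniteCompletion.etaFn (GrpCat.of (FreeGroup X)) (FreeGroup.of x)

/-- The continuous endomorphism of the free profinite group that extends an endomorphism of the
free group. -/
noncomputable def map (f : FreeGroup X →* FreeGroup X) :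
    FreeProfiniteGroup X →ₜ* FreeProfiniteGroup X :=
  (ProfiniteGrp.profiniteCompletion.map (GrpCat.ofHom f)).hom

theorem map_etaFn (f : FreeGroup X →* FreeGroup X) (w : FreeGroup X) :
    map f (ProfiniteGrp.ProfiniteCompletion.etaFn (GrpCat.of (FreeGroup X)) w) =
      ProfiniteGrp.ProfiniteCompletion.etaFn (GrpCat.of (FreeGroup X)) (f w) := by
  have h := ProfiniteGrp.ProfiniteCompletion.lift_eta
    (CategoryTheory.CategoryStruct.comp (GrpCat.ofHom f)
      (ProfiniteGrp.ProfiniteCompletion.eta (GrpCat.of (FreeGroup X))))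
  exact CategoryTheory.ConcreteCategory.congr_hom h w

/-- The `ω`-power of an endomorphism of the free profinite group on a finite set that comes from
an endomorphism of the free group is a genuine limit. -/
theorem tendsto_omegaPow_map [Finite X] (f : FreeGroup X →* FreeGroup X)
    (x : FreeProfiniteGroup X) :
    Tendsto (fun n : ℕ => (map f)^[n.factorial] x) atTop (𝓝 (omegaPow (map f) x)) := by
  have key : ∀ H : OpenNormalSubgroup (FreeProfiniteGroup X), ∃ N : ℕ, ∀ n, N ≤ n →
      ((map f)^[N.factorial] x)⁻¹ * (map f)^[n.factorial] x ∈ H := by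
    intro H
    let Q := FreeProfiniteGroup X ⧸ H.toSubgroup
    have : Finite Q := inferInstanceAs (Finite (FreeProfiniteGroup X ⧸ H.toOpenSubgroup.toSubgroup))
    have : DiscreteTopology Q := QuotientGroup.discreteTopology H.isOpen'
    let q : FreeProfiniteGroup X →* Q := QuotientGroup.mk' H.toSubgroup
    have hq : Continuous q := QuotientGroup.continuous_mk
    let η := ProfiniteGrp.ProfiniteCompletion.etaFn (GrpCat.of (FreeGroup X))
    let ηh : FreeGroup X →* FreeProfiniteGroup X :=
      (ProfiniteGrp.ProfiniteCompletion.eta (GrpCat.of (FreeGroup X))).hom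
    let g : (X → Q) → (X → Q) := fun h y => FreeGroup.lift h (f (FreeGroup.of y))
    let h0 : X → Q := fun y => q (η (FreeGroup.of y))
    have hl : ∀ h, FreeGroup.lift (g h) = (FreeGroup.lift h).comp f := by
      intro h; ext y; simp [g]
    have h0w : FreeGroup.lift h0 = q.comp ηh := by
      ext y; simp only [FreeGroup.lift_apply_of]; rfl
    have hk : ∀ (k : ℕ) (w : FreeGroup X), FreeGroup.lift (g^[k] h0) w = q ((map f)^[k] (η w)) := by
      intro k
      induction k with
      | zero => intro w; exact DFunLike.congr_fun h0w w
      | succ k ih =>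
        intro w
        rw [Function.iterate_succ_apply', hl, MonoidHom.comp_apply, ih]
        exact congrArg (fun z => q ((map f)^[k] z)) (map_etaFn f w).symm
    obtain ⟨N, hN⟩ := iterate_factorial_eventually_const g h0
    refine ⟨N, fun n hn => ?_⟩
    have hcont : ∀ k : ℕ, Continuous fun z => q ((map f)^[k] z) :=
      fun k => hq.comp ((map f).continuous_toFun.iterate k)
    have heq : (fun z => q ((map f)^[N.factorial] z)) = fun z => q ((map f)^[n.factorial] z) := by
      refine (ProfiniteGrp.ProfiniteCompletion.denseRange
        (GrpCat.of (FreeGroup X))).equalizer (hcont _) (hcont _) ?_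
      funext w
      show q ((map f)^[N.factorial] (η w)) = q ((map f)^[n.factorial] (η w))
      rw [← hk, ← hk, hN n hn]
    exact QuotientGroup.eq.1 (congrFun heq x)
  obtain ⟨l, hl⟩ : ∃ l, MapClusterPt l atTop fun n : ℕ => (map f)^[n.factorial] x :=
    exists_clusterPt_of_compactSpace _
  refine tendsto_omegaPow (l := l) ?_
  intro U hU
  obtain ⟨V, hVU, hV, hlV⟩ := mem_nhds_iff.1 hU
  obtain ⟨H, hH⟩ := ProfiniteGrp.exist_openNormalSubgroup_sub_open_nhds_of_one
    (U := (fun z => l * z) ⁻¹' V) (hV.preimage (continuous_const_mul l)) (by simpa using hlV)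
  obtain ⟨N, hN⟩ := key H
  have hnb : {z | l⁻¹ * z ∈ H} ∈ 𝓝 l := by
    refine (H.isOpen'.preimage (continuous_const_mul l⁻¹)).mem_nhds ?_
    show l⁻¹ * l ∈ H.toSubgroup
    simp
  obtain ⟨m, hm, hml⟩ := ((hl.frequently hnb).and_eventually (eventually_ge_atTop N)).exists
  refine mem_map.2 ?_
  filter_upwards [eventually_ge_atTop N] with n hn
  refine hVU ?_
  have h1 : l⁻¹ * (map f)^[n.factorial] x ∈ H.toSubgroup := by
    have h2 := H.toSubgroup.mul_mem (H.toSubgroup.mul_mem hm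
      (H.toSubgroup.inv_mem (hN m hml))) (hN n hn)
    convert h2 using 1
    group
  have := hH h1
  simpa using this

end FreeProfiniteGroup

instance closedNormalClosure_normal {G : Type*} [TopologicalSpace G] [Group G]
    [IsTopologicalGroup G] (R : Set G) : (Subgroup.normalClosure R).topologicalClosure.Normal :=
  Subgroup.is_normal_topologicalClosure _

/-- The profinite group with generators `X` and relations `r = 1` (`r ∈ R`): the quotient of the
free profinite group on `X` by the closure of the normal closure of `R`. -/
abbrev PresentedProfiniteGroup {X : Type u} (R : Set (FreeProfiniteGroup X)) : Type u :=
  FreeProfiniteGroup X ⧸ (Subgroup.normalClosure R).topologicalClosure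

/-! ### Encodings of bounded delay -/

section Words

variable {A : Type u}

/-- The concatenation of a list of nonempty words. -/
def concatWords (us : List (FreeSemigroup A)) : FreeMonoid A :=
  (us.map FreeSemigroup.toFreeMonoid).prod

/-- The equality `u₁ ⋯ uₘ = v₁ ⋯ vₙ` is reducible: there are `1 ≤ r ≤ m` and `1 ≤ s ≤ n` with
`2 < r + s ≤ m + n` and `uᵣ ⋯ uₘ = vₛ ⋯ vₙ`. -/
def IsReducibleEquality (us vs : List (FreeSemigroup A)) : Prop :=
  ∃ r s : ℕ, 1 ≤ r ∧ r ≤ us.length ∧ 1 ≤ s ∧ s ≤ vs.length ∧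
    2 < r + s ∧ r + s ≤ us.length + vs.length ∧
    concatWords (us.drop (r - 1)) = concatWords (vs.drop (s - 1))

/-- The set of words `C` is of bounded delay with respect to the language `L`: there is `N` such
that every equality `u c₁ ⋯ cₘ v = c₁' ⋯ cₙ'` or `u c₁ ⋯ cₘ = c₁' ⋯ cₙ' v` between words of `L`
with `cᵢ, cⱼ' ∈ C`, `u` a suffix and `v` a prefix of words of `C`, and `m + n > N`, is
reducible. -/
def IsBoundedDelay (C L : Set (FreeSemigroup A)) : Prop :=
  ∃ N : ℕ, ∀ (u v : FreeSemigroup A) (cs cs' : List (FreeSemigroup A)),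
    (∃ c ∈ C, IsSuffixOf u c) → (∃ c ∈ C, IsPrefixOf v c) →
    (∀ c ∈ cs, c ∈ C) → (∀ c ∈ cs', c ∈ C) → N < cs.length + cs'.length →
    (∀ w ∈ L, concatWords (u :: cs ++ [v]) = w.toFreeMonoid →
      concatWords cs' = w.toFreeMonoid → IsReducibleEquality (u :: cs ++ [v]) cs') ∧
    (∀ w ∈ L, concatWords (u :: cs) = w.toFreeMonoid →
      concatWords (cs' ++ [v]) = w.toFreeMonoid → IsReducibleEquality (u :: cs) (cs' ++ [v]))

end Words

/-! ### Weakly primitive substitutions -/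

/-- A substitution over the alphabet `A`: an endomorphism of the free semigroup `A⁺`. -/
abbrev Substitution (A : Type u) : Type u := FreeSemigroup A →ₙ* FreeSemigroup A

namespace Substitution

open FreeSemigroup (of)

variable {A : Type u} (φ : Substitution A)

/-- For some `n ≥ 1`, the words `φⁿ(a)` (`a ∈ A`) all have length at least two and the same
factors of length two. -/
def IsWeaklyPrimitive : Prop :=
  ∃ n : ℕ, 0 < n ∧ (∀ a : A, 2 ≤ (φ^[n] (of a)).length) ∧
    ∀ (a b : A) (w : FreeSemigroup A), w.length = 2 →
      (IsFactorOf w (φ^[n] (of a)) ↔ IsFactorOf w (φ^[n] (of b)))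

/-- The language `L(X_φ)` of finite blocks of the subshift of a weakly primitive substitution:
the words that are factors of `φᵏ(a)` for every letter `a` and all sufficiently large `k`. -/
def language : Set (FreeSemigroup A) :=
  {w | ∃ K : ℕ, ∀ k, K ≤ k → ∀ a : A, IsFactorOf w (φ^[k] (of a))}

/-- `J(φ)`: the infinite elements of the topological closure of the language `L(X_φ)` in the free
profinite semigroup. -/
def jClass : Set (FreeProfiniteSemigroup A) :=
  closure (FreeProfiniteSemigroup.ofWord '' φ.language) \
    (FreeProfiniteSemigroup.ofWord '' φ.language)

/-- The language of all finite words that are factors of elements of `J(φ)`. -/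
def factorsJ : Set (FreeSemigroup A) :=
  {w | ∃ s ∈ φ.jClass, IsFactorOf (FreeProfiniteSemigroup.ofWord w) s}

/-- `φ` is an encoding of bounded delay with respect to the factors of `J(φ)`. -/
def IsEncodingOfBoundedDelay : Prop :=
  Function.Injective φ ∧ IsBoundedDelay (Set.range fun a => φ (of a)) φ.factorsJ

/-- The idempotent continuous endomorphism `φ^ω` of the free profinite semigroup. -/
noncomputable def omega : FreeProfiniteSemigroup A → FreeProfiniteSemigroup A :=
  omegaPow (FreeProfiniteSemigroup.map φ)

/-- The group `G(φ)`, for the connection `ba`: the intersection of the `R`-class of `φ^ω(a)` with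
the `L`-class of `φ^ω(b)` in the free profinite semigroup. -/
def schutzenbergerGroup (a b : A) : Set (FreeProfiniteSemigroup A) :=
  {s | GreenR s (φ.omega (FreeProfiniteSemigroup.ofWord (of a))) ∧
    GreenL s (φ.omega (FreeProfiniteSemigroup.ofWord (of b)))}

/-- The set `R(u)` of return words of `u` in the subshift: the nonempty words `v` such that `vu`
is in the language, `u` is a prefix of `vu`, and `u` occurs in `vu` only as a prefix and as a
suffix. -/
def returnWords (u : FreeSemigroup A) : Set (FreeSemigroup A) :=
  {v | v * u ∈ φ.language ∧ IsPrefixOf u (v * u) ∧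
    ∀ x y : WithOne (FreeSemigroup A),
      ((v * u : FreeSemigroup A) : WithOne (FreeSemigroup A)) = x * u * y → x = 1 ∨ y = 1}

/-- The set `X_φ(a,b) = b⁻¹ R(ba) b`. -/
def returnGenerators (a b : A) : Set (FreeSemigroup A) :=
  {x | ∃ r ∈ φ.returnWords (of b * of a), of b * x = r * of b}

/-- The homomorphism from the free semigroup on a set `X` of words to `A⁺` that sends each
generator to the word that it is. -/
def decode (X : Set (FreeSemigroup A)) : FreeSemigroup X →ₙ* FreeSemigroup A :=
  FreeSemigroup.lift Subtype.val

/-- `ψ` is the endomorphism `φ_X` of `X⁺` that encodes the action of `φ` on `X⁺`. -/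
def IsInducedBy {X : Set (FreeSemigroup A)} (ψ : Substitution X) : Prop :=
  (decode X).comp ψ = φ.comp (decode X)

/-- The endomorphism of the free group on `X` that agrees on the generators with a
substitution `ψ` over `X`. -/
def toFreeGroupHom (ψ : Substitution A) : FreeGroup A →* FreeGroup A :=
  FreeGroup.lift fun x => FreeSemigroup.lift FreeGroup.of (ψ (of x))

/-- The relators `ψ_G^ω(x) x⁻¹` (`x ∈ X`) in the free profinite group on `X`, where `ψ_G` is the
continuous endomorphism induced by a substitution `ψ` over `X`. -/
def omegaRelators (ψ : Substitution A) : Set (FreeProfiniteGroup A) :=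
  Set.range fun x : A =>
    omegaPow (FreeProfiniteGroup.map ψ.toFreeGroupHom) (FreeProfiniteGroup.gen x) *
      (FreeProfiniteGroup.gen x)⁻¹

end Substitution

/-! Let `p = φ^ω(a)` and `q = φ^ω(b)`. Every element of the closure of the language is a factor of
every `φ^ω(c)`, so stability of compact semigroups shows that an element of this closure in `pS ∩
Sq` lies in `G(φ)`, where `S` is the free profinite semigroup. Since `qp = φ^ω(ba)` also lies in the
closure, `G(φ)` is closed under products; being compact, it is a profinite group
(`IsProper.exists_group_one`). Hence `x ↦ φ^ω(x)` extends to a continuous homomorphism `θ` from the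
free profinite group on `X` to `G(φ)` (`FreeProfiniteGroup.exists_hom`). It remains to find its
image and its kernel.

Image: bounded delay allows long words of the language to be desubstituted, and compactness turns
this into the surjectivity of `φ` on `G(φ)` (`IsProper.exists_preimage`). So each `g` in `G(φ)` is a
high iterate `φ^k(s)`. Approximating `s` by a word `w`, and using that high iterates of any word are
products of elements of `X`, one sees that `g` is a limit of values of `θ`
(`IsProper.exists_decode_approx`). The image of `θ` is compact, hence contains `g`.

Kernel: the relators are killed because `φ^ω` is idempotent (`hom_eq_of_mem_relations`). Conversely,
the elements of `X` start with `a`, end with `b` and avoid `ba`, so a product of them is decoded by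
cutting at each `ba`. A finite automaton does this, so every homomorphism from `X⁺` to a finite
group factors, on decoded words, through a finite quotient of `A⁺` (`exists_finiteIndexCon_decode`).
Suppose that `θ y = 1` and that `χ` is a finite quotient map killing the relators. Then `χ` is
invariant under `φ_X^{n!}` on positive words for large `n`. For a positive word `w` close to `y`,
the decoded word of `φ_X^{n!}(w)` is close to `θ y`, which is idempotent; hence `χ(w) = χ(y)` is
idempotent, that is, trivial (`mem_relations_of_hom_eq`). -/

/-! ### Words as lists of letters -/

namespace FreeSemigroup

variable {A : Type u}

/-- The list of the letters of a word. -/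
def letters (w : FreeSemigroup A) : List A := w.head :: w.tail

theorem letters_ne_nil (w : FreeSemigroup A) : w.letters ≠ [] := List.cons_ne_nil _ _

@[simp] theorem letters_of (a : A) : (of a).letters = [a] := rfl

@[simp] theorem letters_mul (v w : FreeSemigroup A) : (v * w).letters = v.letters ++ w.letters := rfl

theorem letters_injective : Function.Injective (letters : FreeSemigroup A → List A) := by
  intro v w h
  rw [letters, letters, List.cons.injEq] at h
  exact FreeSemigroup.ext h.1 h.2

theorem exists_letters_eq {l : List A} (h : l ≠ []) : ∃ w : FreeSemigroup A, w.letters = l := by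
  obtain ⟨x, t, rfl⟩ := List.exists_cons_of_ne_nil h
  exact ⟨⟨x, t⟩, rfl⟩

theorem letters_length (w : FreeSemigroup A) : w.letters.length = w.length := rfl

theorem toFreeMonoid_eq (w : FreeSemigroup A) :
    FreeSemigroup.toFreeMonoid w = FreeMonoid.ofList w.letters :=
  FreeSemigroup.toFreeMonoid_mk_eq_cons _ _

/-- The letters of a possibly empty word. -/
def lettersOne : WithOne (FreeSemigroup A) →* FreeMonoid A := WithOne.lift FreeSemigroup.toFreeMonoid

theorem lettersOne_coe (w : FreeSemigroup A) :
    lettersOne (w : WithOne (FreeSemigroup A)) = FreeMonoid.ofList w.letters := by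
  rw [lettersOne, WithOne.lift_coe, toFreeMonoid_eq]

theorem lettersOne_injective :
    Function.Injective (lettersOne : WithOne (FreeSemigroup A) → FreeMonoid A) := by
  intro x y
  refine WithOne.cases_on x ?_ fun v => ?_ <;> refine WithOne.cases_on y ?_ fun w => ?_
  · exact fun _ => rfl
  · rw [map_one, lettersOne_coe]
    exact fun h => absurd (FreeMonoid.ofList.injective h).symm (letters_ne_nil _)
  · rw [map_one, lettersOne_coe]
    exact fun h => absurd (FreeMonoid.ofList.injective h) (letters_ne_nil _)
  · rw [lettersOne_coe, lettersOne_coe]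
    exact fun h => by rw [letters_injective (FreeMonoid.ofList.injective h)]

theorem exists_lettersOne_eq (l : List A) :
    ∃ x : WithOne (FreeSemigroup A), lettersOne x = FreeMonoid.ofList l := by
  rcases eq_or_ne l [] with rfl | h
  · exact ⟨1, map_one _⟩
  · obtain ⟨w, rfl⟩ := exists_letters_eq h
    exact ⟨w, lettersOne_coe w⟩

theorem isFactorOf_iff {v w : FreeSemigroup A} : IsFactorOf v w ↔ v.letters <:+: w.letters := by
  constructor
  · rintro ⟨x, y, h⟩
    refine ⟨(lettersOne x).toList, (lettersOne y).toList, ?_⟩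
    have := congrArg lettersOne h
    rw [map_mul, map_mul, lettersOne_coe, lettersOne_coe] at this
    exact (congrArg FreeMonoid.toList this).symm
  · rintro ⟨s, t, h⟩
    obtain ⟨x, hx⟩ := exists_lettersOne_eq s
    obtain ⟨y, hy⟩ := exists_lettersOne_eq t
    refine ⟨x, y, lettersOne_injective ?_⟩
    rw [map_mul, map_mul, lettersOne_coe, lettersOne_coe, hx, hy, ← h]
    rfl

theorem isPrefixOf_iff {v w : FreeSemigroup A} : IsPrefixOf v w ↔ v.letters <+: w.letters := by
  constructor
  · rintro ⟨y, h⟩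
    refine ⟨(lettersOne y).toList, ?_⟩
    have := congrArg lettersOne h
    rw [map_mul, lettersOne_coe, lettersOne_coe] at this
    exact (congrArg FreeMonoid.toList this).symm
  · rintro ⟨t, h⟩
    obtain ⟨y, hy⟩ := exists_lettersOne_eq t
    refine ⟨y, lettersOne_injective ?_⟩
    rw [map_mul, lettersOne_coe, lettersOne_coe, hy, ← h]
    rfl

theorem isSuffixOf_iff {v w : FreeSemigroup A} : IsSuffixOf v w ↔ v.letters <:+ w.letters := by
  constructor
  · rintro ⟨y, h⟩
    refine ⟨(lettersOne y).toList, ?_⟩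
    have := congrArg lettersOne h
    rw [map_mul, lettersOne_coe, lettersOne_coe] at this
    exact (congrArg FreeMonoid.toList this).symm
  · rintro ⟨t, h⟩
    obtain ⟨y, hy⟩ := exists_lettersOne_eq t
    refine ⟨y, lettersOne_injective ?_⟩
    rw [map_mul, lettersOne_coe, lettersOne_coe, hy, ← h]
    rfl

theorem letters_hom {B : Type*} (f : FreeSemigroup A →ₙ* FreeSemigroup B) (w : FreeSemigroup A) :
    (f w).letters = w.letters.flatMap fun c => (f (of c)).letters := by
  induction w using FreeSemigroup.recOnMul with
  | ih1 a => simp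
  | ih2 a y ha hy => rw [map_mul, letters_mul, letters_mul, List.flatMap_append, ← ha, ← hy]

end FreeSemigroup

/-! ### Occurrences of a word in a concatenation of words -/

namespace List

variable {A B : Type*}

/-- The block `f c` contains the first letter of `w`: since `s ≠ []`, a cut at a block boundary is
assigned to the block on its right. -/
theorem exists_split_of_append_eq_flatMap (f : A → List B) :
    ∀ (l : List A) (α w : List B), α ++ w = l.flatMap f → w ≠ [] →
      ∃ l₁ c l₂ s' s, l = l₁ ++ c :: l₂ ∧ f c = s' ++ s ∧ s ≠ [] ∧
        α = l₁.flatMap f ++ s' ∧ w = s ++ l₂.flatMap f := by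
  intro l
  induction l with
  | nil =>
    intro α w h hw
    exact absurd (append_eq_nil_iff.1 (h.trans flatMap_nil)).2 hw
  | cons d l ih =>
    intro α w h hw
    rw [flatMap_cons, append_eq_append_iff] at h
    have shift : ∀ α', α = f d ++ α' → l.flatMap f = α' ++ w →
        ∃ l₁ c l₂ s' s, d :: l = l₁ ++ c :: l₂ ∧ f c = s' ++ s ∧ s ≠ [] ∧
          α = l₁.flatMap f ++ s' ∧ w = s ++ l₂.flatMap f := by
      rintro α' rfl h2
      obtain ⟨l₁, c, l₂, s', s, rfl, hc, hs, rfl, hw'⟩ := ih α' w h2.symm hw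
      exact ⟨d :: l₁, c, l₂, s', s, rfl, hc, hs, by simp, hw'⟩
    rcases h with ⟨s, h1, h2⟩ | ⟨α', h1, h2⟩
    · rcases eq_or_ne s [] with rfl | hs
      · exact shift [] (by simpa using h1.symm) (by simpa using h2.symm)
      · exact ⟨[], d, l, α, s, rfl, h1, hs, by simp, h2⟩
    · exact shift α' h1 h2

/-- The block `f c` contains the last letter of `w`: since `p ≠ []`, a cut at a block boundary is
assigned to the block on its left. -/
theorem exists_split_of_append_eq_flatMap' (f : A → List B) :
    ∀ (l : List A) (w β : List B), w ++ β = l.flatMap f → w ≠ [] →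
      ∃ l₁ c l₂ p p', l = l₁ ++ c :: l₂ ∧ f c = p ++ p' ∧ p ≠ [] ∧
        w = l₁.flatMap f ++ p ∧ β = p' ++ l₂.flatMap f := by
  intro l
  induction l with
  | nil =>
    intro w β h hw
    exact absurd (append_eq_nil_iff.1 (h.trans flatMap_nil)).1 hw
  | cons d l ih =>
    intro w β h hw
    rw [flatMap_cons, append_eq_append_iff] at h
    rcases h with ⟨s, h1, h2⟩ | ⟨w', h1, h2⟩
    · exact ⟨[], d, l, w, s, rfl, h1, hw, by simp, h2⟩
    · rcases eq_or_ne w' [] with rfl | hs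
      · refine ⟨[], d, l, f d, [], rfl, by simp, ?_, by simpa using h1, by simpa using h2.symm⟩
        rintro h0
        exact hw (by simp [h1, h0])
      · obtain ⟨l₁, c, l₂, p, p', rfl, hc, hp, rfl, rfl⟩ := ih w' β h2.symm hs
        exact ⟨d :: l₁, c, l₂, p, p', rfl, hc, hp, by simp [h1], rfl⟩

/-- An occurrence of a long word in a concatenation of short words: the word is the concatenation
of a suffix of a block, some complete blocks, and a prefix of a block. -/
theorem exists_decomposition_of_flatMap (f : A → List B) {M : ℕ} (hM : ∀ c, (f c).length ≤ M)
    {l : List A} {α w β : List B} (h : α ++ w ++ β = l.flatMap f) (hw : M < w.length) :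
    ∃ l₁ c l₂ c' l₃ s' s p p', l = l₁ ++ c :: (l₂ ++ c' :: l₃) ∧ f c = s' ++ s ∧ s ≠ [] ∧
      f c' = p ++ p' ∧ p ≠ [] ∧ α = l₁.flatMap f ++ s' ∧ w = s ++ (l₂.flatMap f ++ p) ∧
      β = p' ++ l₃.flatMap f := by
  have hw0 : w ≠ [] := by rintro rfl; simp at hw
  rw [append_assoc] at h
  obtain ⟨l₁, c, l', s', s, rfl, hc, hs, hα, hwβ⟩ :=
    exists_split_of_append_eq_flatMap f l α (w ++ β) h (by simp [hw0])
  -- The first partial block is too short to contain all of `w`, so the end of `w` falls in a later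
  -- block.
  have hsl : s.length ≤ M := by
    have := hM c
    rw [hc, length_append] at this
    omega
  rcases append_eq_append_iff.1 hwβ with ⟨t, h1, _⟩ | ⟨w₁, rfl, h2⟩
  · rw [h1, length_append] at hsl; omega
  · have hw₁ : w₁ ≠ [] := by rintro rfl; simp at hw; omega
    obtain ⟨l₂, c', l₃, p, p', rfl, hc', hp, rfl, hβ⟩ :=
      exists_split_of_append_eq_flatMap' f l' w₁ β h2.symm hw₁
    exact ⟨l₁, c, l₂, c', l₃, s', s, p, p', rfl, hc, hs, hc', hp, hα, rfl, hβ⟩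

end List

/-! ### The language of a weakly primitive substitution -/

namespace Substitution

open FreeSemigroup (of letters)

variable {A : Type u} (φ : Substitution A)

/-- The action of a substitution on lists of letters. -/
def onList (l : List A) : List A := l.flatMap fun c => (φ (of c)).letters

theorem letters_apply (w : FreeSemigroup A) : (φ w).letters = φ.onList w.letters :=
  FreeSemigroup.letters_hom φ w

theorem letters_iterate (k : ℕ) (w : FreeSemigroup A) :
    (φ^[k] w).letters = φ.onList^[k] w.letters := by
  induction k with
  | zero => rfl
  | succ k ih => rw [Function.iterate_succ_apply', Function.iterate_succ_apply', letters_apply, ih]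

@[simp] theorem onList_nil : φ.onList [] = [] := rfl

@[simp] theorem onList_append (l m : List A) : φ.onList (l ++ m) = φ.onList l ++ φ.onList m :=
  List.flatMap_append

theorem onList_singleton (c : A) : φ.onList [c] = (φ (of c)).letters := by simp [onList]

theorem onList_ne_nil {l : List A} (h : l ≠ []) : φ.onList l ≠ [] := by
  obtain ⟨w, rfl⟩ := FreeSemigroup.exists_letters_eq h
  rw [← letters_apply]
  exact FreeSemigroup.letters_ne_nil _

theorem onList_eq_nil {l : List A} : φ.onList l = [] ↔ l = [] :=
  ⟨fun h => by_contra fun h' => φ.onList_ne_nil h' h, fun h => by simp [h]⟩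

theorem onList_injective (h : Function.Injective φ) : Function.Injective φ.onList := by
  intro l m hlm
  rcases eq_or_ne l [] with rfl | hl
  · exact (φ.onList_eq_nil.1 hlm.symm).symm
  rcases eq_or_ne m [] with rfl | hm
  · exact φ.onList_eq_nil.1 hlm
  obtain ⟨v, rfl⟩ := FreeSemigroup.exists_letters_eq hl
  obtain ⟨w, rfl⟩ := FreeSemigroup.exists_letters_eq hm
  rw [← letters_apply, ← letters_apply] at hlm
  rw [h (FreeSemigroup.letters_injective hlm)]

theorem length_le_onList (l : List A) : l.length ≤ (φ.onList l).length := by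
  induction l with
  | nil => simp
  | cons c l ih =>
    rw [← List.singleton_append, onList_append, List.length_append, List.length_append,
      onList_singleton]
    have := List.length_pos_iff.2 (FreeSemigroup.letters_ne_nil (φ (of c)))
    simp only [List.length_singleton]
    omega

theorem iterate_onList_append (k : ℕ) (l m : List A) :
    φ.onList^[k] (l ++ m) = φ.onList^[k] l ++ φ.onList^[k] m := by
  induction k with
  | zero => rfl
  | succ k ih => simp only [Function.iterate_succ_apply', ih, onList_append]

theorem iterate_onList_nil (k : ℕ) : φ.onList^[k] [] = [] := by
  induction k with
  | zero => rfl
  | succ k ih => rw [Function.iterate_succ_apply', ih, onList_nil]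

theorem iterate_onList_eq_flatMap (k : ℕ) (l : List A) :
    φ.onList^[k] l = l.flatMap fun c => φ.onList^[k] [c] := by
  induction l with
  | nil => rw [iterate_onList_nil]; rfl
  | cons c l ih => rw [← List.singleton_append, iterate_onList_append, ih]; simp

theorem iterate_onList_ne_nil (k : ℕ) {l : List A} (h : l ≠ []) : φ.onList^[k] l ≠ [] := by
  induction k with
  | zero => exact h
  | succ k ih => rw [Function.iterate_succ_apply']; exact φ.onList_ne_nil ih

/-- The words, as lists of letters and including the empty word, of the language of `φ`. -/
def listLanguage : Set (List A) := {l | ∃ K : ℕ, ∀ k, K ≤ k → ∀ c : A, l <:+: φ.onList^[k] [c]}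

variable {φ}

theorem mem_language_iff {w : FreeSemigroup A} : w ∈ φ.language ↔ w.letters ∈ φ.listLanguage := by
  simp only [language, listLanguage, Set.mem_ofPred_eq, FreeSemigroup.isFactorOf_iff,
    letters_iterate, FreeSemigroup.letters_of]

theorem mem_listLanguage_of_infix {l m : List A} (hm : m ∈ φ.listLanguage) (h : l <:+: m) :
    l ∈ φ.listLanguage := by
  obtain ⟨K, hK⟩ := hm
  exact ⟨K, fun k hk c => h.trans (hK k hk c)⟩

theorem onList_mem_listLanguage {l : List A} (h : l ∈ φ.listLanguage) :
    φ.onList l ∈ φ.listLanguage := by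
  obtain ⟨K, hK⟩ := h
  refine ⟨K + 1, fun k hk c => ?_⟩
  obtain ⟨k, rfl⟩ := Nat.exists_eq_add_of_le' (Nat.one_le_of_lt hk)
  rw [Function.iterate_succ_apply']
  exact (hK k (by omega) c).flatMap _

theorem iterate_onList_mem_listLanguage {l : List A} (h : l ∈ φ.listLanguage) (k : ℕ) :
    φ.onList^[k] l ∈ φ.listLanguage := by
  induction k with
  | zero => exact h
  | succ k ih => rw [Function.iterate_succ_apply']; exact onList_mem_listLanguage ih

theorem IsWeaklyPrimitive.two_le_length_iterate {n : ℕ}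
    (h : ∀ c : A, 2 ≤ (φ^[n] (of c)).length) (c : A) : 2 ≤ (φ.onList^[n] [c]).length := by
  have := h c
  rwa [← FreeSemigroup.letters_length, letters_iterate, FreeSemigroup.letters_of] at this

theorem exists_pair_infix {l : List A} (hl : 2 ≤ l.length) {d : A} (hd : d ∈ l) :
    ∃ x y, [x, y] <:+: l ∧ d ∈ [x, y] := by
  obtain ⟨s, t, rfl⟩ := List.append_of_mem hd
  rcases eq_or_ne t [] with rfl | ht
  · have hs : s ≠ [] := by rintro rfl; simp at hl
    refine ⟨s.getLast hs, d, ⟨s.dropLast, [], ?_⟩, by simp⟩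
    conv_rhs => rw [← List.dropLast_append_getLast hs]
    simp
  · obtain ⟨y, t, rfl⟩ := List.exists_cons_of_ne_nil ht
    exact ⟨d, y, ⟨s, t, by simp⟩, by simp⟩

/-- All letters of `φⁿ(c)`, for a suitable `n`, belong to the language. -/
theorem IsWeaklyPrimitive.exists_letters_mem (h : φ.IsWeaklyPrimitive) :
    ∃ n : ℕ, (∀ c : A, 2 ≤ (φ.onList^[n] [c]).length) ∧
      ∀ (l : List A) (d : A), d ∈ φ.onList^[n] l → [d] ∈ φ.listLanguage := by
  obtain ⟨n, -, h2, hf⟩ := h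
  have h2' := IsWeaklyPrimitive.two_le_length_iterate h2
  -- Each letter lies in a factor of length two, and the images have the same such factors, so they
  -- have the same letters.
  have key : ∀ c d c' : A, d ∈ φ.onList^[n] [c] → d ∈ φ.onList^[n] [c'] := by
    intro c d c' hd
    obtain ⟨x, y, hxy, hd'⟩ := exists_pair_infix (h2' c) hd
    have := (hf c c' ⟨x, [y]⟩ rfl).1 (by
      rw [FreeSemigroup.isFactorOf_iff, letters_iterate]; exact hxy)
    rw [FreeSemigroup.isFactorOf_iff, letters_iterate] at this
    exact this.subset hd'
  refine ⟨n, h2', fun l d hd => ⟨n, fun k hk c => ?_⟩⟩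
  rw [iterate_onList_eq_flatMap, List.mem_flatMap] at hd
  obtain ⟨c₀, -, hd⟩ := hd
  obtain ⟨k, rfl⟩ := Nat.exists_eq_add_of_le hk
  rw [Function.iterate_add_apply, List.singleton_infix_iff, iterate_onList_eq_flatMap,
    List.mem_flatMap]
  obtain ⟨e, he⟩ := List.exists_mem_of_ne_nil _ (φ.iterate_onList_ne_nil k (List.cons_ne_nil c []))
  exact ⟨e, he, key c₀ d e hd⟩

theorem IsWeaklyPrimitive.exists_letter_mem [Nonempty A] (h : φ.IsWeaklyPrimitive) :
    ∃ d : A, [d] ∈ φ.listLanguage := by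
  obtain ⟨n, h2, hn⟩ := h.exists_letters_mem
  have c : A := Classical.arbitrary A
  obtain ⟨d, hd⟩ := List.exists_mem_of_ne_nil _ (φ.iterate_onList_ne_nil n (List.cons_ne_nil c []))
  exact ⟨d, hn _ d hd⟩

/-- Three consecutive letters give a letter with neighbours on both sides, whose image under `φᴷ` is
then properly surrounded. This is what `exists_extension` needs. -/
theorem IsWeaklyPrimitive.exists_long_mem [Nonempty A] (h : φ.IsWeaklyPrimitive) :
    ∃ x y z t, x :: y :: z :: t ∈ φ.listLanguage := by
  obtain ⟨n, h2, hn⟩ := h.exists_letters_mem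
  obtain ⟨d, hd⟩ := h.exists_letter_mem
  have hlen : 3 ≤ (φ.onList^[n] (φ.onList^[n] [d])).length := by
    obtain ⟨x, l, hl⟩ := List.exists_cons_of_ne_nil
      (φ.iterate_onList_ne_nil n (List.cons_ne_nil d []))
    have h3 := h2 d
    rw [hl] at h3 ⊢
    obtain ⟨y, l, rfl⟩ := List.exists_cons_of_ne_nil (l := l) (by rintro rfl; simp at h3)
    rw [show x :: y :: l = [x] ++ ([y] ++ l) from rfl, iterate_onList_append,
      iterate_onList_append, List.length_append, List.length_append]
    have := h2 x
    have := h2 y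
    omega
  have hmem := iterate_onList_mem_listLanguage (iterate_onList_mem_listLanguage hd n) n
  match φ.onList^[n] (φ.onList^[n] [d]), hlen, hmem with
  | x :: y :: z :: t, _, hmem => exact ⟨x, y, z, t, hmem⟩

/-- Words of the language can be extended on both sides in the language. -/
theorem IsWeaklyPrimitive.exists_extension (h : φ.IsWeaklyPrimitive) {l : List A}
    (hl : l ∈ φ.listLanguage) [Nonempty A] :
    ∃ x y, x ≠ [] ∧ y ≠ [] ∧ x ++ l ++ y ∈ φ.listLanguage := by
  obtain ⟨a, b, c, t, hm⟩ := h.exists_long_mem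
  obtain ⟨K, hK⟩ := hl
  obtain ⟨s, s', hs⟩ := hK K le_rfl b
  refine ⟨φ.onList^[K] [a] ++ s, s' ++ φ.onList^[K] (c :: t), ?_, ?_, ?_⟩
  · simp [φ.iterate_onList_ne_nil]
  · simp [φ.iterate_onList_ne_nil]
  · have := iterate_onList_mem_listLanguage hm K
    rw [show a :: b :: c :: t = [a] ++ ([b] ++ (c :: t)) from rfl, iterate_onList_append,
      iterate_onList_append, ← hs] at this
    simpa using this

/-- Words of the language are factors of images of words of the language. -/
theorem IsWeaklyPrimitive.exists_infix_onList [Nonempty A] (h : φ.IsWeaklyPrimitive) {l : List A}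
    (hl : l ∈ φ.listLanguage) (j : ℕ) : ∃ m ∈ φ.listLanguage, l <:+: φ.onList^[j] m := by
  obtain ⟨d, hd⟩ := h.exists_letter_mem
  obtain ⟨K, hK⟩ := hl
  refine ⟨φ.onList^[K] [d], iterate_onList_mem_listLanguage hd K, ?_⟩
  rw [← Function.iterate_add_apply]
  exact hK _ (by omega) d

/-- With `n` from weak primitivity, each application of `φⁿ` at least doubles the length. -/
theorem IsWeaklyPrimitive.exists_length_le (h : φ.IsWeaklyPrimitive) (N : ℕ) :
    ∃ K, ∀ k, K ≤ k → ∀ l : List A, l ≠ [] → N ≤ (φ.onList^[k] l).length := by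
  obtain ⟨n, h2, hn⟩ := h.exists_letters_mem
  have grow : ∀ l : List A, 2 * l.length ≤ (φ.onList^[n] l).length := by
    intro l
    induction l with
    | nil => simp
    | cons c l ih =>
      rw [← List.singleton_append, iterate_onList_append, List.length_append, List.length_append]
      have := h2 c
      simp only [List.length_singleton]
      omega
  have grow' : ∀ i (l : List A), l ≠ [] → i < (φ.onList^[i * n] l).length := by
    intro i l hl
    induction i with
    | zero => simpa using List.length_pos_iff.2 hl
    | succ i ih =>
      rw [show (i + 1) * n = n + i * n by ring, Function.iterate_add_apply]
      have := grow (φ.onList^[i * n] l)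
      omega
  refine ⟨N * n, fun k hk l hl => ?_⟩
  obtain ⟨k, rfl⟩ := Nat.exists_eq_add_of_le hk
  rw [Function.iterate_add_apply]
  exact (grow' N _ (φ.iterate_onList_ne_nil k hl)).le

/-- Long words of the language contain every given word of the language. -/
theorem IsWeaklyPrimitive.infix_of_length_lt [Finite A] [Nonempty A] (h : φ.IsWeaklyPrimitive)
    {l : List A} (hl : l ∈ φ.listLanguage) :
    ∃ M, ∀ m ∈ φ.listLanguage, M < m.length → l <:+: m := by
  obtain ⟨K, hK⟩ := hl
  obtain ⟨M, hM⟩ : ∃ M, ∀ c, (φ.onList^[K] [c]).length ≤ M := by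
    obtain ⟨M, hM⟩ := (Set.finite_range fun c => (φ.onList^[K] [c]).length).bddAbove
    exact ⟨M, fun c => hM ⟨c, rfl⟩⟩
  -- Inside a concatenation of blocks `φᴷ(d)` of length at most `M`, a word longer than `2M`
  -- contains a complete block, and each block contains `l`.
  refine ⟨2 * M, fun m hm hlen => ?_⟩
  obtain ⟨m', -, α, β, h'⟩ := h.exists_infix_onList hm K
  rw [iterate_onList_eq_flatMap] at h'
  obtain ⟨l₁, c, l₂, c', l₃, s', s, p, p', rfl, hc, hs, hc', hp, rfl, rfl, rfl⟩ :=
    List.exists_decomposition_of_flatMap _ hM h' (by omega)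
  have h1 := hM c
  have h2 := hM c'
  rw [hc] at h1
  rw [hc'] at h2
  simp only [List.length_append] at h1 h2 hlen
  obtain ⟨d, t, rfl⟩ := List.exists_cons_of_ne_nil (l := l₂) (by rintro rfl; simp at hlen; omega)
  refine (hK K le_rfl d).trans ⟨s, t.flatMap (fun c => φ.onList^[K] [c]) ++ p, by simp⟩

end Substitution

/-! ### Return words -/

namespace Substitution

open FreeSemigroup (of letters)

variable {A : Type u} {φ : Substitution A} {a b : A}

theorem forall_occurrence_iff (z u : FreeSemigroup A) :
    (∀ x y : WithOne (FreeSemigroup A),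
      (z : WithOne (FreeSemigroup A)) = x * u * y → x = 1 ∨ y = 1) ↔
    ∀ s t : List A, z.letters = s ++ u.letters ++ t → s = [] ∨ t = [] := by
  have hone : ∀ x : WithOne (FreeSemigroup A), x = 1 ↔ FreeSemigroup.lettersOne x =
      FreeMonoid.ofList [] := fun x =>
    ⟨fun h => by rw [h, map_one]; rfl, fun h =>
      FreeSemigroup.lettersOne_injective (h.trans (map_one FreeSemigroup.lettersOne).symm)⟩
  constructor
  · intro h s t hst
    obtain ⟨x, hx⟩ := FreeSemigroup.exists_lettersOne_eq s
    obtain ⟨y, hy⟩ := FreeSemigroup.exists_lettersOne_eq t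
    have := h x y (FreeSemigroup.lettersOne_injective (by
      rw [map_mul, map_mul, FreeSemigroup.lettersOne_coe, FreeSemigroup.lettersOne_coe, hx, hy, hst]
      rfl))
    rw [hone, hone, hx, hy] at this
    exact this
  · intro h x y hxy
    have hxy' := congrArg FreeSemigroup.lettersOne hxy
    rw [map_mul, map_mul, FreeSemigroup.lettersOne_coe, FreeSemigroup.lettersOne_coe] at hxy'
    rw [hone, hone]
    exact h (FreeSemigroup.lettersOne x).toList (FreeSemigroup.lettersOne y).toList
      (congrArg FreeMonoid.toList hxy')

/-- A word that starts with `a`, ends with `b`, and does not have `ba` as a factor. -/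
structure IsBlock (a b : A) (l : List A) : Prop where
  head : ∃ t, l = a :: t
  last : ∃ t, l = t ++ [b]
  not_infix : ¬ [b, a] <:+: l

/-- From `bx = rb` one gets `rba = bxa`. That `ba` occurs there as a prefix and as a suffix fixes
the first and the last letter of `x`; that it occurs nowhere else means that `x` avoids `ba`. -/
theorem mem_returnGenerators_iff {x : FreeSemigroup A} :
    x ∈ φ.returnGenerators a b ↔
      IsBlock a b x.letters ∧ [b] ++ x.letters ++ [a] ∈ φ.listLanguage := by
  have hba : (of b * of a).letters = [b, a] := rfl
  constructor
  · rintro ⟨r, ⟨hrL, hrp, hocc⟩, hx⟩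
    have hx' := congrArg letters hx
    rw [FreeSemigroup.letters_mul, FreeSemigroup.letters_mul, FreeSemigroup.letters_of] at hx'
    have hr : (r * (of b * of a)).letters = [b] ++ x.letters ++ [a] := by
      rw [hx', FreeSemigroup.letters_mul, hba]; simp
    rw [forall_occurrence_iff, hr, hba] at hocc
    rw [FreeSemigroup.isPrefixOf_iff, hr, hba] at hrp
    rw [mem_language_iff, hr] at hrL
    refine ⟨⟨?_, ?_, ?_⟩, hrL⟩
    · obtain ⟨t, ht⟩ := hrp
      obtain ⟨c, l, hl⟩ := List.exists_cons_of_ne_nil x.letters_ne_nil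
      rw [hl] at ht ⊢
      simp only [List.cons_append, List.nil_append, List.cons.injEq, true_and] at ht
      exact ⟨l, by rw [ht.1]⟩
    · obtain ⟨c, l, hl⟩ := List.exists_cons_of_ne_nil r.letters_ne_nil
      rw [hl] at hx'
      simp only [List.cons_append, List.nil_append, List.cons.injEq] at hx'
      exact ⟨l, hx'.2⟩
    · rintro ⟨s, t, hst⟩
      rcases hocc (b :: s) (t ++ [a]) (by rw [← hst]; simp) with h | h <;> simp at h
  · rintro ⟨⟨⟨t, ht⟩, ⟨s, hs⟩, hn⟩, hL⟩
    obtain ⟨r, hr⟩ := FreeSemigroup.exists_letters_eq (List.cons_ne_nil b s)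
    have hrx : (r * (of b * of a)).letters = [b] ++ x.letters ++ [a] := by
      rw [FreeSemigroup.letters_mul, hba, hr, hs]; simp
    refine ⟨r, ⟨?_, ?_, ?_⟩, FreeSemigroup.letters_injective (by simp [hr, hs])⟩
    · rw [mem_language_iff, hrx]; exact hL
    · rw [FreeSemigroup.isPrefixOf_iff, hrx, hba, ht]
      exact ⟨t ++ [a], by simp⟩
    · rw [forall_occurrence_iff, hrx, hba]
      intro u v huv
      by_contra! hne
      obtain ⟨c, u, rfl⟩ := List.exists_cons_of_ne_nil hne.1
      rcases List.eq_nil_or_concat' v with rfl | ⟨v, d, rfl⟩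
      · exact hne.2 rfl
      · have huv' : (x.letters) ++ [a] = (u ++ [b, a] ++ v) ++ [d] := by
          simp only [List.cons_append, List.nil_append, List.cons.injEq] at huv
          simpa using huv.2
        exact hn ⟨u, v, (List.append_inj' huv' rfl).1.symm⟩

/-- A word `w` that starts with `a` and ends with `b`, such that `bwa` is in the language, is a
product of return generators. -/
theorem exists_decode_eq : ∀ w : FreeSemigroup A, (∃ t, w.letters = a :: t) →
    (∃ t, w.letters = t ++ [b]) → [b] ++ w.letters ++ [a] ∈ φ.listLanguage →
    ∃ v, decode (φ.returnGenerators a b) v = w := by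
  suffices H : ∀ (n : ℕ) (w : FreeSemigroup A), w.letters.length ≤ n → (∃ t, w.letters = a :: t) →
      (∃ t, w.letters = t ++ [b]) → [b] ++ w.letters ++ [a] ∈ φ.listLanguage →
      ∃ v, decode (φ.returnGenerators a b) v = w from fun w => H _ w le_rfl
  intro n
  induction n with
  | zero =>
    intro w h
    exact absurd (List.length_eq_zero_iff.1 (Nat.le_zero.1 h)) w.letters_ne_nil
  | succ n ih =>
    intro w hlen ha hb hL
    -- An occurrence of `ba` is cut between its two letters: the left part is then followed by `a`
    -- and the right part preceded by `b`, so both inherit the hypotheses.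
    by_cases hn : [b, a] <:+: w.letters
    · obtain ⟨s, t, hst⟩ := hn
      obtain ⟨w₁, h₁⟩ := FreeSemigroup.exists_letters_eq (l := s ++ [b]) (by simp)
      obtain ⟨w₂, h₂⟩ := FreeSemigroup.exists_letters_eq (List.cons_ne_nil a t)
      have hw : w = w₁ * w₂ := FreeSemigroup.letters_injective (by
        rw [FreeSemigroup.letters_mul, h₁, h₂, ← hst]; simp)
      have hl : w.letters.length = s.length + 1 + (t.length + 1) := by
        rw [hw, FreeSemigroup.letters_mul, h₁, h₂]; simp; omega
      obtain ⟨v₁, hv₁⟩ := ih w₁ (by rw [h₁]; simp; omega) (by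
          obtain ⟨r, hr⟩ := ha
          rw [h₁]
          rw [← hst] at hr
          cases s with
          | nil => exact ⟨[], by simp at hr; simp [hr.1]⟩
          | cons c s => exact ⟨s ++ [b], by simp at hr; simp [hr.1]⟩) ⟨s, h₁⟩
        (mem_listLanguage_of_infix hL ⟨[], t ++ [a], by rw [h₁, ← hst]; simp⟩)
      obtain ⟨v₂, hv₂⟩ := ih w₂ (by rw [h₂]; simp; omega) ⟨t, h₂⟩ (by
          obtain ⟨r, hr⟩ := hb
          rw [h₂]
          rw [← hst] at hr
          rcases List.eq_nil_or_concat' t with rfl | ⟨t, d, rfl⟩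
          · refine ⟨[], ?_⟩
            have := congrArg List.getLast? hr
            simp at this
            simp [this]
          · refine ⟨a :: t, ?_⟩
            have := congrArg List.getLast? hr
            rw [← List.append_assoc, List.getLast?_concat, List.getLast?_concat] at this
            simp [Option.some.inj this])
        (mem_listLanguage_of_infix hL ⟨b :: s, [], by rw [h₂, ← hst]; simp⟩)
      exact ⟨v₁ * v₂, by rw [map_mul, hv₁, hv₂, hw]⟩
    · exact ⟨of ⟨w, mem_returnGenerators_iff.2 ⟨⟨ha, hb, hn⟩, hL⟩⟩, rfl⟩

/-! ### Recognition of products of blocks -/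

section Automaton

variable {H : Type*} [Monoid H]

open Classical in
/-- One step of the automaton that cuts a word at each occurrence of `ba` and multiplies the values
of the complete blocks. The current block is kept up to length `M + 1`. -/
noncomputable def blockStep (a b : A) (χ : List A → H) (M : ℕ)
    (s : H × {l : List A // l.length ≤ M + 1}) (c : A) : H × {l : List A // l.length ≤ M + 1} :=
  if s.2.1.getLast? = some b ∧ c = a then (s.1 * χ s.2.1, ⟨[c], by simp⟩)
  -- The bound keeps the state set finite when `A` and `H` are. The reset to `[]` on overflow is an
  -- arbitrary value, never reached on products of blocks of length at most `M + 1`.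
  else (s.1, if h : s.2.1.length ≤ M then ⟨s.2.1 ++ [c], by simpa using h⟩ else ⟨[], by simp⟩)

theorem foldl_blockStep_within (χ : List A → H) (M : ℕ) (h : H) :
    ∀ (t l : List A) (hl : l.length ≤ M + 1), ¬ [b, a] <:+: l ++ t →
      ∀ ht : (l ++ t).length ≤ M + 1,
      t.foldl (blockStep a b χ M) (h, ⟨l, hl⟩) = (h, ⟨l ++ t, ht⟩) := by
  intro t
  induction t with
  | nil => intro l hl _ ht; simp
  | cons c t ih =>
    intro l hl hn ht
    have hcond : ¬ (l.getLast? = some b ∧ c = a) := by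
      rintro ⟨h1, rfl⟩
      obtain ⟨l', rfl⟩ := List.getLast?_eq_some_iff.1 h1
      exact hn ⟨l', t, by simp⟩
    have hlM : l.length ≤ M := by simp at ht; omega
    have hstep : blockStep a b χ M (h, ⟨l, hl⟩) c = (h, ⟨l ++ [c], by simpa using hlM⟩) := by
      rw [blockStep, if_neg hcond, dif_pos hlM]
    rw [List.foldl_cons, hstep, ih (l ++ [c]) _ (by simpa using hn) (by simpa using ht)]
    simp

theorem foldl_blockStep_block (χ : List A → H) (M : ℕ)
    (s : H × {l : List A // l.length ≤ M + 1}) (hs : s.2.1.getLast? = some b) {l : List A}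
    (hb : IsBlock a b l) (hl : l.length ≤ M + 1) :
    l.foldl (blockStep a b χ M) s = (s.1 * χ s.2.1, ⟨l, hl⟩) := by
  obtain ⟨t, rfl⟩ := hb.head
  rw [List.foldl_cons, blockStep, if_pos ⟨hs, rfl⟩,
    foldl_blockStep_within χ M _ t [a] (by simp) hb.not_infix hl]
  rfl

variable {X : Set (FreeSemigroup A)}

/-- The last block is still in the buffer, so the quantity that is multiplicative is the first
component times the value of the buffer. The buffer must end with `b` for the next `a` to trigger a
cut. -/
theorem foldl_blockStep_decode (hX : ∀ x ∈ X, IsBlock a b x.letters) {M : ℕ}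
    (hM : ∀ x ∈ X, x.letters.length ≤ M + 1) (f : X → H) (χ : List A → H)
    (hχ : ∀ x : X, χ (letters (x : FreeSemigroup A)) = f x) (w : FreeSemigroup X) :
    ∀ s : H × {l : List A // l.length ≤ M + 1}, s.2.1.getLast? = some b →
      let r := (decode X w).letters.foldl (blockStep a b χ M) s
      r.1 * χ r.2.1 = s.1 * χ s.2.1 * FreeSemigroup.lift f w ∧ r.2.1.getLast? = some b := by
  induction w using FreeSemigroup.recOnMul with
  | ih1 x =>
    intro s hs
    have hx : decode X (of x) = x := rfl
    simp only [hx]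
    rw [foldl_blockStep_block χ M s hs (hX x x.2) (hM x x.2)]
    refine ⟨by simp [hχ], ?_⟩
    obtain ⟨t, ht⟩ := (hX x x.2).last
    simp [ht]
  | ih2 x w ihx ihw =>
    intro s hs
    obtain ⟨h1, h2⟩ := ihx s hs
    obtain ⟨h3, h4⟩ := ihw _ h2
    simp only [map_mul, FreeSemigroup.letters_mul, List.foldl_append]
    exact ⟨by rw [h3, h1, mul_assoc], h4⟩

/-- The initial buffer is empty and does not end with `b`, so the first block is read without a cut;
`foldl_blockStep_decode` applies from there on. -/
theorem foldl_blockStep_one (hX : ∀ x ∈ X, IsBlock a b x.letters) {M : ℕ}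
    (hM : ∀ x ∈ X, x.letters.length ≤ M + 1) (f : X → H) (χ : List A → H)
    (hχ : ∀ x : X, χ (letters (x : FreeSemigroup A)) = f x) (w : FreeSemigroup X) :
    let r := (decode X w).letters.foldl (blockStep a b χ M) (1, ⟨[], by simp⟩)
    r.1 * χ r.2.1 = FreeSemigroup.lift f w := by
  have h0 : ∀ x : X, (letters (x : FreeSemigroup A)).foldl (blockStep a b χ M)
      ((1 : H), ⟨[], by simp⟩) = (1, ⟨letters (x : FreeSemigroup A), hM x x.2⟩) := fun x =>
    foldl_blockStep_within χ M 1 _ [] (by simp) (hX x x.2).not_infix (hM x x.2)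
  induction w using FreeSemigroup.recOnMul with
  | ih1 x =>
    have hx : decode X (of x) = x := rfl
    simp only [hx]
    rw [h0]
    simp [hχ]
  | ih2 x w ihx ihw =>
    have hx : decode X (of x) = x := rfl
    simp only [map_mul, FreeSemigroup.letters_mul, List.foldl_append, hx]
    rw [h0]
    obtain ⟨t, ht⟩ := (hX x x.2).last
    rw [(foldl_blockStep_decode hX hM f χ hχ w _ (by simp [ht])).1]
    simp [hχ]

theorem exists_extension_letters (f : X → H) :
    ∃ χ : List A → H, ∀ x : X, χ (letters (x : FreeSemigroup A)) = f x := by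
  refine ⟨Function.extend (fun x : X => letters (x : FreeSemigroup A)) f 1, fun x => ?_⟩
  exact (FreeSemigroup.letters_injective.comp Subtype.val_injective).extend_apply f 1 x

theorem exists_length_bound (hfin : X.Finite) : ∃ M, ∀ x ∈ X, x.letters.length ≤ M + 1 := by
  obtain ⟨M, hM⟩ := (hfin.image fun x => x.letters.length).bddAbove
  exact ⟨M, fun x hx => (hM ⟨x, hx, rfl⟩).trans (Nat.le_succ M)⟩

/-- A finite set of blocks is a code. -/
theorem decode_injective (hX : ∀ x ∈ X, IsBlock a b x.letters) (hfin : X.Finite) :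
    Function.Injective (decode X) := by
  obtain ⟨M, hM⟩ := exists_length_bound hfin
  -- With values in the free monoid on `X`, the automaton outputs the factorization itself.
  let f : X → FreeMonoid X := FreeMonoid.of
  obtain ⟨χ, hχ⟩ := exists_extension_letters f
  intro v w h
  have h1 := foldl_blockStep_one hX hM f χ hχ v
  have h2 := foldl_blockStep_one hX hM f χ hχ w
  rw [h] at h1
  exact FreeSemigroup.toFreeMonoid_injective (h1.symm.trans h2)

/-- Homomorphisms from the free semigroup on a finite set of blocks to finite monoids only depend
on the decoded word modulo a congruence of finite index. -/
theorem exists_finiteIndexCon_decode [Finite A] [Finite H] (hX : ∀ x ∈ X, IsBlock a b x.letters)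
    (hfin : X.Finite) (f : X → H) :
    ∃ c : FiniteIndexCon A, ∀ v w : FreeSemigroup X,
      ((decode X v : FreeSemigroup A) : c.1.Quotient) = (decode X w : FreeSemigroup A) →
      FreeSemigroup.lift f v = FreeSemigroup.lift f w := by
  obtain ⟨M, hM⟩ := exists_length_bound hfin
  obtain ⟨χ, hχ⟩ := exists_extension_letters f
  let T := H × {l : List A // l.length ≤ M + 1}
  have : Finite {l : List A // l.length ≤ M + 1} := List.finite_length_le A (M + 1)
  let run : FreeSemigroup A → T → T := fun w s => w.letters.foldl (blockStep a b χ M) s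
  have hrun : ∀ v w s, run (v * w) s = run w (run v s) := fun v w s => by
    simp only [run, FreeSemigroup.letters_mul, List.foldl_append]
  -- Two words are identified when they act in the same way on the finite state set.
  let c : Con (FreeSemigroup A) :=
    { r := fun v w => run v = run w
      iseqv := ⟨fun _ => rfl, Eq.symm, Eq.trans⟩
      mul' := by
        intro v w v' w' h h'
        funext s
        rw [hrun, hrun, h, h'] }
  have hc : Finite c.Quotient := by
    refine Finite.of_injective (β := T → T)
      (fun q : c.Quotient => Con.liftOn q run fun v w h => h) ?_
    intro p q
    induction p using Con.induction_on
    induction q using Con.induction_on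
    intro h
    exact (Con.eq _).2 h
  refine ⟨⟨c, hc⟩, fun v w h => ?_⟩
  have h' : run (decode X v) = run (decode X w) := (Con.eq c).1 h
  have h1 := foldl_blockStep_one hX hM f χ hχ v
  have h2 := foldl_blockStep_one hX hM f χ hχ w
  have h3 := congrFun h' ((1 : H), ⟨[], by simp⟩)
  simp only [run] at h3
  rw [h3] at h1
  exact h1.symm.trans h2

end Automaton

/-! ### The induced substitution on return generators -/

section Induced

theorem onList_head (hfirst : ∀ c : A, IsPrefixOf (of a) (φ (of c))) {l : List A} (hl : l ≠ []) :
    ∃ t, φ.onList l = a :: t := by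
  obtain ⟨c, l, rfl⟩ := List.exists_cons_of_ne_nil hl
  obtain ⟨t, ht⟩ := FreeSemigroup.isPrefixOf_iff.1 (hfirst c)
  rw [← List.singleton_append, onList_append, onList_singleton, ← ht]
  exact ⟨t ++ φ.onList l, by simp⟩

theorem onList_last (hlast : ∀ c : A, IsSuffixOf (of b) (φ (of c))) {l : List A} (hl : l ≠ []) :
    ∃ t, φ.onList l = t ++ [b] := by
  rcases List.eq_nil_or_concat' l with rfl | ⟨l, c, rfl⟩
  · exact absurd rfl hl
  obtain ⟨t, ht⟩ := FreeSemigroup.isSuffixOf_iff.1 (hlast c)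
  rw [onList_append, onList_singleton, ← ht]
  exact ⟨φ.onList l ++ t, by simp⟩

/-- Extend `l` on both sides in the language and apply `φ`: the image of the left extension ends
with `b`, that of the right one starts with `a`. -/
theorem surrounded_onList_mem (hprim : φ.IsWeaklyPrimitive)
    (hfirst : ∀ c : A, IsPrefixOf (of a) (φ (of c)))
    (hlast : ∀ c : A, IsSuffixOf (of b) (φ (of c))) {l : List A} (hL : l ∈ φ.listLanguage) :
    [b] ++ φ.onList l ++ [a] ∈ φ.listLanguage := by
  have : Nonempty A := ⟨a⟩
  obtain ⟨x, y, hx, hy, hm⟩ := hprim.exists_extension hL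
  obtain ⟨s, hs⟩ := onList_last hlast hx
  obtain ⟨t, ht⟩ := onList_head hfirst hy
  refine mem_listLanguage_of_infix (onList_mem_listLanguage hm) ⟨s, t, ?_⟩
  rw [onList_append, onList_append, hs, ht]
  simp

theorem pair_mem (hprim : φ.IsWeaklyPrimitive)
    (hfirst : ∀ c : A, IsPrefixOf (of a) (φ (of c)))
    (hlast : ∀ c : A, IsSuffixOf (of b) (φ (of c))) : [b, a] ∈ φ.listLanguage := by
  have : Nonempty A := ⟨a⟩
  obtain ⟨x, y, z, t, h⟩ := hprim.exists_long_mem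
  have h' : [x] ++ [y] ∈ φ.listLanguage := mem_listLanguage_of_infix h ⟨[], z :: t, by simp⟩
  obtain ⟨s, hs⟩ := onList_last hlast (List.cons_ne_nil x [])
  obtain ⟨t, ht⟩ := onList_head hfirst (List.cons_ne_nil y [])
  refine mem_listLanguage_of_infix (onList_mem_listLanguage h') ⟨s, t, ?_⟩
  rw [onList_append, hs, ht]
  simp

/-- Long words of the language contain `ba`, and blocks do not; hence blocks in the language are
short. -/
theorem finite_returnGenerators (hprim : φ.IsWeaklyPrimitive)
    (hfirst : ∀ c : A, IsPrefixOf (of a) (φ (of c)))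
    (hlast : ∀ c : A, IsSuffixOf (of b) (φ (of c))) [Finite A] : (φ.returnGenerators a b).Finite := by
  have : Nonempty A := ⟨a⟩
  obtain ⟨M, hM⟩ := hprim.infix_of_length_lt (pair_mem hprim hfirst hlast)
  refine Set.Finite.of_injOn (f := letters) (t := {l : List A | l.length ≤ M}) ?_
    FreeSemigroup.letters_injective.injOn (List.finite_length_le A M)
  intro x hx
  obtain ⟨hb, hL⟩ := mem_returnGenerators_iff.1 hx
  by_contra hlt
  exact hb.not_infix (hM _ (mem_listLanguage_of_infix hL ⟨[b], [a], rfl⟩) (not_le.1 hlt))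

theorem exists_decode_eq_apply (hprim : φ.IsWeaklyPrimitive)
    (hfirst : ∀ c : A, IsPrefixOf (of a) (φ (of c)))
    (hlast : ∀ c : A, IsSuffixOf (of b) (φ (of c))) {w : FreeSemigroup A} (hw : w ∈ φ.language) :
    ∃ v, decode (φ.returnGenerators a b) v = φ w := by
  refine exists_decode_eq (φ w) ?_ ?_ ?_ <;> rw [letters_apply]
  · exact onList_head hfirst w.letters_ne_nil
  · exact onList_last hlast w.letters_ne_nil
  · exact surrounded_onList_mem hprim hfirst hlast (mem_language_iff.1 hw)

theorem nonempty_returnGenerators (hprim : φ.IsWeaklyPrimitive)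
    (hfirst : ∀ c : A, IsPrefixOf (of a) (φ (of c)))
    (hlast : ∀ c : A, IsSuffixOf (of b) (φ (of c))) : Nonempty (φ.returnGenerators a b) := by
  have hb : of b ∈ φ.language := mem_language_iff.2
    (mem_listLanguage_of_infix (pair_mem hprim hfirst hlast) ⟨[], [a], rfl⟩)
  obtain ⟨v, -⟩ := exists_decode_eq_apply hprim hfirst hlast hb
  exact ⟨v.head⟩

theorem isBlock_of_mem {x : FreeSemigroup A} (hx : x ∈ φ.returnGenerators a b) :
    IsBlock a b x.letters := (mem_returnGenerators_iff.1 hx).1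

theorem returnGenerators_subset_language : φ.returnGenerators a b ⊆ φ.language := fun _ hx =>
  mem_language_iff.2 (mem_listLanguage_of_infix (mem_returnGenerators_iff.1 hx).2 ⟨[b], [a], rfl⟩)

/-- The substitution on the return generators that encodes the given one exists and is unique. -/
theorem existsUnique_isInducedBy (hprim : φ.IsWeaklyPrimitive)
    (hfirst : ∀ c : A, IsPrefixOf (of a) (φ (of c)))
    (hlast : ∀ c : A, IsSuffixOf (of b) (φ (of c))) [Finite A] :
    ∃! ψ : Substitution (φ.returnGenerators a b), φ.IsInducedBy ψ := by
  have hex : ∀ x : φ.returnGenerators a b, ∃ v, decode (φ.returnGenerators a b) v = φ x :=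
    fun x => exists_decode_eq_apply hprim hfirst hlast
      (returnGenerators_subset_language x.2)
  choose v hv using hex
  have hinj : Function.Injective (decode (φ.returnGenerators a b)) :=
    decode_injective (fun x hx => isBlock_of_mem hx)
      (finite_returnGenerators hprim hfirst hlast)
  refine ⟨FreeSemigroup.lift v, ?_, fun ψ hψ => ?_⟩
  · apply FreeSemigroup.hom_ext
    funext x
    simp only [Function.comp_apply, MulHom.comp_apply, FreeSemigroup.lift_of, hv]
    rfl
  · apply FreeSemigroup.hom_ext
    funext x
    apply hinj
    simp only [Function.comp_apply, FreeSemigroup.lift_of, hv]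
    exact DFunLike.congr_fun hψ (of x)

/-- High iterates of a substitution map all words to products of return generators. -/
theorem exists_decode_eq_iterate (hprim : φ.IsWeaklyPrimitive)
    (hfirst : ∀ c : A, IsPrefixOf (of a) (φ (of c)))
    (hlast : ∀ c : A, IsSuffixOf (of b) (φ (of c))) :
    ∃ N, ∀ k, N ≤ k → ∀ w : FreeSemigroup A,
      ∃ v, decode (φ.returnGenerators a b) v = φ^[k] w := by
  obtain ⟨n, -, hn⟩ := hprim.exists_letters_mem
  -- The word itself need not be in the language: it suffices to decode the image of each of its
  -- letters separately.
  have hletter : ∀ u : FreeSemigroup A, (∀ d ∈ u.letters, [d] ∈ φ.listLanguage) →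
      ∃ v, decode (φ.returnGenerators a b) v = φ u := by
    intro u
    induction u using FreeSemigroup.recOnMul with
    | ih1 c =>
      intro h
      exact exists_decode_eq_apply hprim hfirst hlast (mem_language_iff.2 (h c (by simp)))
    | ih2 c u hc hu =>
      intro h
      obtain ⟨v₁, h₁⟩ := hc fun d hd => h d (by
        rw [FreeSemigroup.letters_mul]; exact List.mem_append_left _ hd)
      obtain ⟨v₂, h₂⟩ := hu fun d hd => h d (by
        rw [FreeSemigroup.letters_mul]; exact List.mem_append_right _ hd)
      exact ⟨v₁ * v₂, by rw [map_mul, map_mul, h₁, h₂]⟩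
  refine ⟨n + 1, fun k hk w => ?_⟩
  obtain ⟨k, rfl⟩ := Nat.exists_eq_add_of_le hk
  rw [show n + 1 + k = 1 + (n + k) by ring, Function.iterate_add_apply, Function.iterate_one]
  refine hletter _ fun d hd => ?_
  rw [letters_iterate, Function.iterate_add_apply] at hd
  exact hn _ d hd

end Induced

end Substitution

/-! ### The topology of the free profinite semigroup -/

theorem FreeSemigroup.mul_eq_mul_cases {A : Type u} {u v x y : FreeSemigroup A}
    (h : u * v = x * y) :
    (u = x ∧ v = y) ∨ (∃ t, x = u * t ∧ v = t * y) ∨ ∃ t, u = x * t ∧ y = t * v := by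
  have h' := congrArg letters h
  rw [letters_mul, letters_mul, List.append_eq_append_iff] at h'
  rcases h' with ⟨t, h1, h2⟩ | ⟨t, h1, h2⟩
  · rcases eq_or_ne t [] with rfl | ht
    · exact Or.inl ⟨letters_injective (by simpa using h1.symm), letters_injective (by simpa using h2)⟩
    · obtain ⟨t, rfl⟩ := exists_letters_eq ht
      exact Or.inr (Or.inl ⟨t, letters_injective h1, letters_injective h2⟩)
  · rcases eq_or_ne t [] with rfl | ht
    · exact Or.inl ⟨letters_injective (by simpa using h1), letters_injective (by simpa using h2.symm)⟩
    · obtain ⟨t, rfl⟩ := exists_letters_eq ht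
      exact Or.inr (Or.inr ⟨t, letters_injective h1, letters_injective h2⟩)

namespace FiniteIndexCon

variable {A : Type u}

/-- The intersection of two congruences of finite index. -/
def inf (c d : FiniteIndexCon A) : FiniteIndexCon A := ⟨c.1 ⊓ d.1, by
  have := c.2
  have := d.2
  refine Finite.of_injective
    (fun q : (c.1 ⊓ d.1).Quotient =>
      (Con.liftOn q (fun w => ((w : c.1.Quotient), (w : d.1.Quotient)))
        fun v w h => Prod.ext ((Con.eq _).2 h.1) ((Con.eq _).2 h.2) :
          c.1.Quotient × d.1.Quotient)) ?_
  intro p q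
  induction p using Con.induction_on
  induction q using Con.induction_on
  intro h
  exact (Con.eq _).2 ⟨(Con.eq _).1 (congrArg Prod.fst h), (Con.eq _).1 (congrArg Prod.snd h)⟩⟩

theorem inf_le_left (c d : FiniteIndexCon A) : (inf c d).1 ≤ c.1 := _root_.inf_le_left

theorem inf_le_right (c d : FiniteIndexCon A) : (inf c d).1 ≤ d.1 := _root_.inf_le_right

/-- Congruences of finite index separate the words of bounded length from all other words. -/
theorem exists_isolating [Finite A] (ℓ : ℕ) : ∃ c : FiniteIndexCon A, ∀ v w : FreeSemigroup A,
    w.length ≤ ℓ → (v : c.1.Quotient) = w → v = w := by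
  -- The Rees congruence that collapses all words longer than `ℓ` into one class.
  let c : Con (FreeSemigroup A) :=
    { r := fun v w => v = w ∨ (ℓ < v.length ∧ ℓ < w.length)
      iseqv := ⟨fun _ => Or.inl rfl, fun h => h.imp Eq.symm And.symm, fun {x y z} h h' => by
        rcases h with rfl | h
        · exact h'
        · rcases h' with rfl | h'
          · exact Or.inr h
          · exact Or.inr ⟨h.1, h'.2⟩⟩
      mul' := by
        intro v w v' w' h h'
        rcases h with rfl | h
        · rcases h' with rfl | h'
          · exact Or.inl rfl
          · refine Or.inr ?_
            rw [FreeSemigroup.length_mul, FreeSemigroup.length_mul]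
            omega
        · refine Or.inr ?_
          rw [FreeSemigroup.length_mul, FreeSemigroup.length_mul]
          omega }
  have hfin : Finite {w : FreeSemigroup A // w.length ≤ ℓ} :=
    Set.Finite.of_injOn (f := FreeSemigroup.letters) (t := {l : List A | l.length ≤ ℓ})
      (fun w hw => hw) FreeSemigroup.letters_injective.injOn (List.finite_length_le A ℓ)
  classical
  have hc : Finite c.Quotient := by
    refine Finite.of_injective (β := Option {w : FreeSemigroup A // w.length ≤ ℓ})
      (fun q : c.Quotient => Con.liftOn q
        (fun w => if h : w.length ≤ ℓ then some ⟨w, h⟩ else none) fun v w h => ?_) ?_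
    · rcases h with rfl | h
      · rfl
      · simp [not_le.2 h.1, not_le.2 h.2]
    · intro p q
      induction p using Con.induction_on with | _ v
      induction q using Con.induction_on with | _ w
      intro h
      refine (Con.eq _).2 ?_
      simp only [Con.liftOn_coe] at h
      by_cases hv : v.length ≤ ℓ <;> by_cases hw : w.length ≤ ℓ <;> simp [hv, hw] at h
      · exact Or.inl h
      · exact Or.inr ⟨not_le.1 hv, not_le.1 hw⟩
  refine ⟨⟨c, hc⟩, fun v w hw h => ?_⟩
  rcases (Con.eq c).1 h with h | h
  · exact h
  · omega

/-- The classes of the two factors in all factorizations of a word. -/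
def splittings (c : FiniteIndexCon A) (w : FreeSemigroup A) :
    Set (c.1.Quotient × c.1.Quotient) :=
  {p | ∃ u v : FreeSemigroup A, w = u * v ∧ p = ((u : c.1.Quotient), (v : c.1.Quotient))}

theorem splittings_mul (c : FiniteIndexCon A) (x y : FreeSemigroup A) :
    c.splittings (x * y) = {((x : c.1.Quotient), (y : c.1.Quotient))} ∪
      (fun p => (p.1, p.2 * (y : c.1.Quotient))) '' c.splittings x ∪
      (fun p => ((x : c.1.Quotient) * p.1, p.2)) '' c.splittings y := by
  ext p
  constructor
  · rintro ⟨u, v, h, rfl⟩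
    rcases FreeSemigroup.mul_eq_mul_cases h.symm with ⟨rfl, rfl⟩ | ⟨t, rfl, rfl⟩ | ⟨t, rfl, rfl⟩
    · exact Or.inl (Or.inl rfl)
    · exact Or.inl (Or.inr ⟨_, ⟨u, t, rfl, rfl⟩, rfl⟩)
    · exact Or.inr ⟨_, ⟨t, v, rfl, rfl⟩, rfl⟩
  · rintro ((rfl | ⟨_, ⟨u, t, rfl, rfl⟩, rfl⟩) | ⟨_, ⟨t, v, rfl, rfl⟩, rfl⟩)
    · exact ⟨x, y, rfl, rfl⟩
    · exact ⟨u, t * y, mul_assoc _ _ _, rfl⟩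
    · exact ⟨x * t, v, (mul_assoc _ _ _).symm, rfl⟩

/-- Words that are close to a product split into factors that are close to the given factors. -/
theorem exists_splitting (c : FiniteIndexCon A) : ∃ d : FiniteIndexCon A,
    ∀ (w : FreeSemigroup A) (x y : FreeProfiniteSemigroup A), (x * y).1 d = w →
      ∃ u v : FreeSemigroup A, w = u * v ∧ x.1 c = u ∧ y.1 c = v := by
  have := c.2
  let κ : FreeSemigroup A → c.1.Quotient × Set (c.1.Quotient × c.1.Quotient) :=
    fun w => (w, c.splittings w)
  -- Refine `c` by recording the set of splittings. By `splittings_mul` this is again a congruence,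
  -- and the recorded data range over a finite set.
  let d : Con (FreeSemigroup A) :=
    { r := fun v w => κ v = κ w
      iseqv := ⟨fun _ => rfl, Eq.symm, Eq.trans⟩
      mul' := by
        intro v w v' w' h h'
        obtain ⟨h1, h2⟩ := Prod.mk.inj h
        obtain ⟨h1', h2'⟩ := Prod.mk.inj h'
        refine Prod.ext ?_ ?_
        · simp only [κ, Con.coe_mul, h1, h1']
        · simp only [κ, splittings_mul, h1, h1', h2, h2'] }
  have hd : Finite d.Quotient := by
    refine Finite.of_injective (fun q : d.Quotient => Con.liftOn q κ fun v w h => h) ?_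
    intro p q
    induction p using Con.induction_on
    induction q using Con.induction_on
    intro h
    exact (Con.eq _).2 h
  have hdc : d ≤ c.1 := fun {v w} h => (Con.eq _).1 (Prod.mk.inj h).1
  refine ⟨⟨d, hd⟩, fun w x y h => ?_⟩
  obtain ⟨x', hx⟩ := x.exists_rep ⟨d, hd⟩
  obtain ⟨y', hy⟩ := y.exists_rep ⟨d, hd⟩
  rw [FreeProfiniteSemigroup.mul_apply, hx, hy, ← Con.coe_mul] at h
  have h' : c.splittings (x' * y') = c.splittings w := (Prod.mk.inj ((Con.eq d).1 h)).2
  obtain ⟨u, v, rfl, huv⟩ : ((x' : c.1.Quotient), (y' : c.1.Quotient)) ∈ c.splittings w :=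
    h' ▸ ⟨x', y', rfl, rfl⟩
  obtain ⟨h1, h2⟩ := Prod.mk.inj huv
  exact ⟨u, v, rfl, by rw [x.2 ⟨d, hd⟩ c hdc x' hx, h1], by rw [y.2 ⟨d, hd⟩ c hdc y' hy, h2]⟩

end FiniteIndexCon

namespace FreeProfiniteSemigroup

variable {A : Type u}

theorem val_eq_of_le {c d : FiniteIndexCon A} (h : c.1 ≤ d.1) {x y : FreeProfiniteSemigroup A}
    (hxy : x.1 c = y.1 c) : x.1 d = y.1 d := by
  obtain ⟨w, hw⟩ := x.exists_rep c
  rw [x.2 c d h w hw, y.2 c d h w (hxy ▸ hw)]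

theorem ofWord_apply (w : FreeSemigroup A) (c : FiniteIndexCon A) : (ofWord w).1 c = w := rfl

theorem isOpen_level (c : FiniteIndexCon A) (T : Set c.1.Quotient) :
    IsOpen {x : FreeProfiniteSemigroup A | x.1 c ∈ T} := by
  let : ∀ c : FiniteIndexCon A, TopologicalSpace c.1.Quotient := fun _ => ⊥
  have : ∀ c : FiniteIndexCon A, DiscreteTopology c.1.Quotient := fun _ => ⟨rfl⟩
  exact (isOpen_discrete T).preimage ((continuous_apply c).comp continuous_induced_dom)

theorem isOpen_level_eq (c : FiniteIndexCon A) (q : c.1.Quotient) :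
    IsOpen {x : FreeProfiniteSemigroup A | x.1 c = q} := isOpen_level c {q}

/-- Since finite-index congruences are closed under finite intersection, one congruence controls a
whole basic neighbourhood. Topological statements thus reduce to single finite quotients. -/
theorem exists_level_subset {x : FreeProfiniteSemigroup A} {U : Set (FreeProfiniteSemigroup A)}
    (hU : U ∈ 𝓝 x) : ∃ c : FiniteIndexCon A, ∀ y : FreeProfiniteSemigroup A,
      y.1 c = x.1 c → y ∈ U := by
  let : ∀ c : FiniteIndexCon A, TopologicalSpace c.1.Quotient := fun _ => ⊥
  rw [nhds_induced, mem_comap] at hU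
  obtain ⟨V, hV, hVU⟩ := hU
  rw [nhds_pi, Filter.mem_pi] at hV
  obtain ⟨I, hI, t, ht, htV⟩ := hV
  suffices H : ∃ c : FiniteIndexCon A, ∀ i ∈ I, c.1 ≤ i.1 by
    obtain ⟨c, hc⟩ := H
    refine ⟨c, fun y hy => hVU (htV fun i hi => ?_)⟩
    show y.1 i ∈ t i
    rw [val_eq_of_le (hc i hi) hy]
    exact mem_of_mem_nhds (ht i)
  clear htV ht t
  induction I, hI using Set.Finite.induction_on with
  | empty => exact ⟨⟨⊤, Finite.of_injective (β := Unit) (fun _ => ()) fun p q _ => by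
      induction p using Con.induction_on
      induction q using Con.induction_on
      exact (Con.eq _).2 trivial⟩, by simp⟩
  | insert _ _ ih =>
    rename_i i s _ _
    obtain ⟨c, hc⟩ := ih
    exact ⟨c.inf i, by
      rintro j (rfl | hj)
      · exact FiniteIndexCon.inf_le_right _ _
      · exact (FiniteIndexCon.inf_le_left _ _).trans (hc j hj)⟩

theorem mem_closure_iff_level {x : FreeProfiniteSemigroup A}
    {T : Set (FreeProfiniteSemigroup A)} :
    x ∈ closure T ↔ ∀ c : FiniteIndexCon A, ∃ y ∈ T, y.1 c = x.1 c := by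
  rw [mem_closure_iff_nhds]
  constructor
  · intro h c
    obtain ⟨y, hy, hyT⟩ := h _ ((isOpen_level_eq c (x.1 c)).mem_nhds rfl)
    exact ⟨y, hyT, hy⟩
  · intro h U hU
    obtain ⟨c, hc⟩ := exists_level_subset hU
    obtain ⟨y, hyT, hy⟩ := h c
    exact ⟨y, hc y hy, hyT⟩

theorem continuous_of_level {T : Type*} [TopologicalSpace T] {f : T → FreeProfiniteSemigroup A}
    (h : ∀ (c : FiniteIndexCon A) (t : T), ∀ᶠ s in 𝓝 t, (f s).1 c = (f t).1 c) : Continuous f := by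
  refine continuous_iff_continuousAt.2 fun t U hU => ?_
  obtain ⟨c, hc⟩ := exists_level_subset hU
  exact (h c t).mono fun s hs => hc _ hs

instance : T2Space (FreeProfiniteSemigroup A) := by
  refine ⟨fun x y hxy => ?_⟩
  obtain ⟨c, hc⟩ : ∃ c, x.1 c ≠ y.1 c := by
    by_contra! h
    exact hxy (FreeProfiniteSemigroup.ext h)
  refine ⟨_, _, isOpen_level_eq c (x.1 c), isOpen_level_eq c (y.1 c), rfl, rfl, ?_⟩
  rw [Set.disjoint_left]
  rintro z h1 h2
  exact hc (h1.symm.trans h2)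

instance : ContinuousMul (FreeProfiniteSemigroup A) := by
  refine ⟨continuous_of_level fun c p => ?_⟩
  have h1 := (continuous_fst.tendsto p).eventually
    ((isOpen_level_eq c (p.1.1 c)).mem_nhds rfl)
  have h2 := (continuous_snd.tendsto p).eventually
    ((isOpen_level_eq c (p.2.1 c)).mem_nhds rfl)
  filter_upwards [h1, h2] with s hs1 hs2
  rw [mul_apply, mul_apply]
  exact congrArg₂ _ hs1 hs2

instance : CompactSpace (FreeProfiniteSemigroup A) := by
  let : ∀ c : FiniteIndexCon A, TopologicalSpace c.1.Quotient := fun _ => ⊥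
  have : ∀ c : FiniteIndexCon A, DiscreteTopology c.1.Quotient := fun _ => ⟨rfl⟩
  have : ∀ c : FiniteIndexCon A, Finite c.1.Quotient := fun c => c.2
  let ι : FreeProfiniteSemigroup A → ∀ c : FiniteIndexCon A, c.1.Quotient := fun x => x.1
  have hι : IsClosedEmbedding ι := by
    refine ⟨⟨⟨rfl⟩, fun x y h => FreeProfiniteSemigroup.ext (congrFun h)⟩, ?_⟩
    have hr : Set.range ι = ⋂ (c : FiniteIndexCon A) (d : FiniteIndexCon A) (_ : c.1 ≤ d.1)
        (w : FreeSemigroup A), {f | f c = (w : c.1.Quotient) → f d = (w : d.1.Quotient)} := by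
      ext f
      simp only [Set.mem_iInter, Set.mem_range]
      exact ⟨by rintro ⟨x, rfl⟩; exact x.2, fun h => ⟨⟨f, h⟩, rfl⟩⟩
    rw [hr]
    refine isClosed_iInter fun c => isClosed_iInter fun d => isClosed_iInter fun _ =>
      isClosed_iInter fun w => ?_
    have h1 : Continuous fun f : (∀ c : FiniteIndexCon A, c.1.Quotient) => (f c, f d) :=
      (continuous_apply c).prodMk (continuous_apply d)
    exact (isClosed_discrete {p : c.1.Quotient × d.1.Quotient | p.1 = w → p.2 = w}).preimage h1
  exact hι.compactSpace

theorem denseRange_ofWord : DenseRange (ofWord : FreeSemigroup A → FreeProfiniteSemigroup A) := by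
  intro x
  refine mem_closure_iff_level.2 fun c => ?_
  obtain ⟨w, hw⟩ := x.exists_rep c
  exact ⟨_, ⟨w, rfl⟩, hw.symm⟩

theorem isClosed_mul_left (p : FreeProfiniteSemigroup A) :
    IsClosed {s | ∃ y, s = p * y} := by
  have : {s | ∃ y, s = p * y} = Set.range (p * ·) := by
    ext s; simp [eq_comm]
  rw [this]
  exact (isCompact_range (continuous_const_mul p)).isClosed

theorem isClosed_mul_right (p : FreeProfiniteSemigroup A) :
    IsClosed {s | ∃ y, s = y * p} := by
  have : {s | ∃ y, s = y * p} = Set.range (· * p) := by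
    ext s; simp [eq_comm]
  rw [this]
  exact (isCompact_range (continuous_mul_const p)).isClosed

theorem isClosed_factors (p : FreeProfiniteSemigroup A) :
    IsClosed {s | ∃ x y, x * s * y = p} := by
  have hK : IsCompact {t : FreeProfiniteSemigroup A × FreeProfiniteSemigroup A ×
      FreeProfiniteSemigroup A | t.1 * t.2.1 * t.2.2 = p} :=
    (isClosed_eq (by fun_prop) continuous_const).isCompact
  have : {s | ∃ x y, x * s * y = p} = (fun t => t.2.1) '' {t : FreeProfiniteSemigroup A ×
      FreeProfiniteSemigroup A × FreeProfiniteSemigroup A | t.1 * t.2.1 * t.2.2 = p} := by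
    ext s
    constructor
    · rintro ⟨x, y, h⟩
      exact ⟨(x, s, y), h, rfl⟩
    · rintro ⟨⟨x, s, y⟩, h, rfl⟩
      exact ⟨x, y, h⟩
  rw [this]
  exact (hK.image (by fun_prop)).isClosed

theorem isClosed_multiples (s : FreeProfiniteSemigroup A) :
    IsClosed {p | ∃ x y, x * s * y = p} := by
  have : {p | ∃ x y, x * s * y = p} = Set.range fun t : FreeProfiniteSemigroup A ×
      FreeProfiniteSemigroup A => t.1 * s * t.2 := by
    ext p; simp
  rw [this]
  exact (isCompact_range (by fun_prop)).isClosed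

/-- Stability: an element that is `J`-equivalent to one of its multiples on the right is
`R`-equivalent to it. -/
theorem stable_right {p u x y : FreeProfiniteSemigroup A} (h : x * (p * u) * y = p) :
    ∃ z, p = p * u * z := by
  -- A nonempty compact subsemigroup. An idempotent `v = uz` of `K` satisfies `pv = p`, because `p =
  -- x'pv = x'pvv`.
  let K : Set (FreeProfiniteSemigroup A) :=
    {v | ∃ y, v = u * y} ∩ {v | ∃ x, x * p * v = p}
  have hK : IsClosed K := by
    refine (isClosed_mul_left u).inter ?_
    have : {v | ∃ x, x * p * v = p} = Prod.snd '' {t : FreeProfiniteSemigroup A ×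
        FreeProfiniteSemigroup A | t.1 * p * t.2 = p} := by
      ext v; simp
    rw [this]
    exact ((isClosed_eq (by fun_prop) continuous_const).isCompact.image continuous_snd).isClosed
  obtain ⟨v, ⟨⟨z, hz⟩, x', hx'⟩, hv⟩ := exists_idempotent_in_compact_subsemigroup
    (fun r => continuous_mul_const r) K ⟨u * y, ⟨y, rfl⟩, x, by simpa only [mul_assoc] using h⟩ hK.isCompact (by
      rintro v ⟨⟨z, rfl⟩, x', hx'⟩ w ⟨⟨z', rfl⟩, x'', hx''⟩
      refine ⟨⟨z * (u * z'), by simp only [mul_assoc]⟩, x'' * x', ?_⟩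
      calc x'' * x' * p * (u * z * (u * z')) = x'' * (x' * p * (u * z)) * (u * z') := by
            simp only [mul_assoc]
        _ = p := by rw [hx', hx''])
  refine ⟨z, ?_⟩
  calc p = x' * p * v := hx'.symm
    _ = x' * p * (v * v) := by rw [hv]
    _ = x' * p * v * v := by simp only [mul_assoc]
    _ = p * u * z := by rw [hx', hz, mul_assoc]

/-- The left-right dual of `stable_right`. -/
theorem stable_left {p u x y : FreeProfiniteSemigroup A} (h : x * (u * p) * y = p) :
    ∃ z, p = z * (u * p) := by
  let K : Set (FreeProfiniteSemigroup A) :=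
    {v | ∃ y, v = y * u} ∩ {v | ∃ x, v * p * x = p}
  have hK : IsClosed K := by
    refine (isClosed_mul_right u).inter ?_
    have : {v | ∃ x, v * p * x = p} = Prod.fst '' {t : FreeProfiniteSemigroup A ×
        FreeProfiniteSemigroup A | t.1 * p * t.2 = p} := by
      ext v; simp
    rw [this]
    exact ((isClosed_eq (by fun_prop) continuous_const).isCompact.image continuous_fst).isClosed
  obtain ⟨v, ⟨⟨z, hz⟩, x', hx'⟩, hv⟩ := exists_idempotent_in_compact_subsemigroup
    (fun r => continuous_mul_const r) K ⟨x * u, ⟨x, rfl⟩, y, by rw [mul_assoc x, h]⟩ hK.isCompact (by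
      rintro v ⟨⟨z, rfl⟩, x', hx'⟩ w ⟨⟨z', rfl⟩, x'', hx''⟩
      refine ⟨⟨z * u * z', by simp only [mul_assoc]⟩, x'' * x', ?_⟩
      calc z * u * (z' * u) * p * (x'' * x') = z * u * (z' * u * p * x'') * x' := by
            simp only [mul_assoc]
        _ = p := by rw [hx'', hx'])
  refine ⟨z, ?_⟩
  calc p = v * p * x' := hx'.symm
    _ = v * v * p * x' := by rw [hv]
    _ = v * (v * p * x') := by simp only [mul_assoc]
    _ = z * (u * p) := by rw [hx', hz, mul_assoc]

/-! ### Factorizations of limits of words -/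

theorem mem_closure_of_mul_mem_closure {L : Set (FreeSemigroup A)}
    (hL : ∀ u v : FreeSemigroup A, u * v ∈ L → u ∈ L ∧ v ∈ L) {x y : FreeProfiniteSemigroup A}
    (h : x * y ∈ closure (ofWord '' L)) :
    x ∈ closure (ofWord '' L) ∧ y ∈ closure (ofWord '' L) := by
  simp only [mem_closure_iff_level] at h ⊢
  have key : ∀ c : FiniteIndexCon A, ∃ u v : FreeSemigroup A, u * v ∈ L ∧ x.1 c = u ∧ y.1 c = v := by
    intro c
    obtain ⟨d, hd⟩ := c.exists_splitting
    obtain ⟨_, ⟨w, hw, rfl⟩, hwd⟩ := h d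
    obtain ⟨u, v, rfl, hu, hv⟩ := hd w x y hwd.symm
    exact ⟨u, v, hw, hu, hv⟩
  constructor <;> intro c <;> obtain ⟨u, v, huv, hu, hv⟩ := key c
  · exact ⟨_, ⟨u, (hL u v huv).1, rfl⟩, hu.symm⟩
  · exact ⟨_, ⟨v, (hL u v huv).2, rfl⟩, hv.symm⟩

/-- If a limit of words of `L` has the given words as prefix and suffix, then it is approximated
by words of `L` with this prefix and suffix. -/
theorem exists_word_between [Finite A] {L : Set (FreeSemigroup A)} {u w : FreeSemigroup A}
    {y : FreeProfiniteSemigroup A} (h : ofWord u * y * ofWord w ∈ closure (ofWord '' L))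
    (c : FiniteIndexCon A) :
    ∃ v : FreeSemigroup A, u * v * w ∈ L ∧ y.1 c = v := by
  -- Modulo this congruence, an approximation of `u` or of `w` is equal to it. The product is split
  -- twice, since it has three factors.
  obtain ⟨i, hi⟩ := FiniteIndexCon.exists_isolating (A := A) (max u.length w.length)
  obtain ⟨d, hd⟩ := (c.inf i).exists_splitting
  obtain ⟨e, he⟩ := (d.inf i).exists_splitting
  obtain ⟨_, ⟨z, hz, rfl⟩, hze⟩ := mem_closure_iff_level.1 h e
  obtain ⟨s, w', rfl, hs, hw'⟩ := he z _ _ hze.symm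
  obtain ⟨u', v, rfl, hu', hv⟩ := hd s _ _ ((ofWord u * y).2 _ _ (FiniteIndexCon.inf_le_left d i) s hs)
  have h1 : u' = u := hi u' u (le_max_left _ _)
    ((ofWord u).2 _ _ (FiniteIndexCon.inf_le_right c i) u' hu').symm
  have h2 : w' = w := hi w' w (le_max_right _ _)
    ((ofWord w).2 _ _ (FiniteIndexCon.inf_le_right d i) w' hw').symm
  subst h1 h2
  exact ⟨v, hz, y.2 _ _ (FiniteIndexCon.inf_le_left c i) v hv⟩

end FreeProfiniteSemigroup

/-! ### The idempotent iterate of a substitution -/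

namespace FreeProfiniteSemigroup

variable {A : Type u} (f : FreeSemigroup A →ₙ* FreeSemigroup A)

theorem iterate_map_ofWord (k : ℕ) (w : FreeSemigroup A) :
    (map f)^[k] (ofWord w) = ofWord (f^[k] w) := by
  induction k with
  | zero => rfl
  | succ k ih => rw [Function.iterate_succ_apply', Function.iterate_succ_apply', ih, map_ofWord]

theorem continuous_iterate_map (k : ℕ) : Continuous (map f)^[k] := (continuous_map f).iterate k

/-- The iterates of a continuous endomorphism are eventually periodic in each finite quotient. -/
theorem exists_period [Finite A] (c : FiniteIndexCon A) :
    ∃ P i : ℕ, 0 < P ∧ ∀ k, i ≤ k → ∀ (q : ℕ) (s : FreeProfiniteSemigroup A),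
      ((map f)^[k + q * P] s).1 c = ((map f)^[k] s).1 c := by
  have := c.2
  -- A homomorphism from `A⁺` to the quotient is given by its values on letters, so composition with
  -- `f` is a self-map of a finite set, whose iterates are eventually periodic.
  let g : (A → c.1.Quotient) → (A → c.1.Quotient) :=
    fun h a => FreeSemigroup.lift h (f (FreeSemigroup.of a))
  let h0 : A → c.1.Quotient := fun a => (FreeSemigroup.of a : FreeSemigroup A)
  have hl : ∀ h, FreeSemigroup.lift (g h) = (FreeSemigroup.lift h).comp f := by
    intro h; apply FreeSemigroup.hom_ext; funext a; simp [g]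
  have h0w : ∀ w : FreeSemigroup A, FreeSemigroup.lift h0 w = (w : c.1.Quotient) := by
    intro w
    induction w using FreeSemigroup.recOnMul with
    | ih1 a => rfl
    | ih2 a y ha hy => rw [map_mul, ha, hy, Con.coe_mul]
  have hk : ∀ (k : ℕ) (w : FreeSemigroup A),
      FreeSemigroup.lift (g^[k] h0) w = ((f^[k] w : FreeSemigroup A) : c.1.Quotient) := by
    intro k
    induction k with
    | zero => intro w; simpa using h0w w
    | succ k ih =>
      intro w
      rw [Function.iterate_succ_apply', hl, MulHom.comp_apply, ih, ← Function.iterate_succ_apply]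
  obtain ⟨i, j, hij, h⟩ : ∃ i j : ℕ, i < j ∧ g^[i] h0 = g^[j] h0 := by
    obtain ⟨i, j, hne, h⟩ := Finite.exists_ne_map_eq_of_infinite fun n : ℕ => g^[n] h0
    rcases lt_or_gt_of_ne hne with hlt | hlt
    · exact ⟨i, j, hlt, h⟩
    · exact ⟨j, i, hlt, h.symm⟩
  have hp : Function.IsPeriodicPt g (j - i) (g^[i] h0) := by
    show g^[j - i] (g^[i] h0) = g^[i] h0
    rw [← Function.iterate_add_apply, Nat.sub_add_cancel hij.le, h]
  refine ⟨j - i, i, by omega, fun k hik q s => ?_⟩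
  have hgk : g^[k + q * (j - i)] h0 = g^[k] h0 := by
    obtain ⟨k, rfl⟩ := Nat.exists_eq_add_of_le' hik
    have hq : g^[q * (j - i)] (g^[i] h0) = g^[i] h0 := hp.const_mul q
    rw [show k + i + q * (j - i) = k + (q * (j - i) + i) by ring, Function.iterate_add_apply,
      Function.iterate_add_apply g (q * (j - i)), hq, ← Function.iterate_add_apply]
  have hdense : (fun s => ((map f)^[k + q * (j - i)] s).1 c) = fun s => ((map f)^[k] s).1 c := by
    let : TopologicalSpace c.1.Quotient := ⊥
    have : DiscreteTopology c.1.Quotient := ⟨rfl⟩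
    have hcont : ∀ n, Continuous fun s => ((map f)^[n] s).1 c := fun n =>
      continuous_def.2 fun T _ => (isOpen_level c T).preimage (continuous_iterate_map f n)
    refine denseRange_ofWord.equalizer (hcont _) (hcont _) ?_
    funext w
    show ((map f)^[k + q * (j - i)] (ofWord w)).1 c = ((map f)^[k] (ofWord w)).1 c
    rw [iterate_map_ofWord, iterate_map_ofWord, ofWord_apply, ofWord_apply, ← hk, ← hk, hgk]
  exact congrFun hdense s

/-- In each finite quotient, the `ω`-power agrees uniformly with some iterates. -/
theorem omegaPow_map_apply [Finite A] (c : FiniteIndexCon A) :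
    ∃ M : ℕ, 0 < M ∧ ∀ k, 0 < k → ∀ s : FreeProfiniteSemigroup A,
      (omegaPow (map f) s).1 c = ((map f)^[k * M] s).1 c := by
  obtain ⟨P, i, hP, h⟩ := exists_period f c
  have h' : ∀ m n, i ≤ m * P → m ≤ n → ∀ s : FreeProfiniteSemigroup A,
      ((map f)^[n * P] s).1 c = ((map f)^[m * P] s).1 c := by
    intro m n hm hmn s
    obtain ⟨q, rfl⟩ := Nat.exists_eq_add_of_le hmn
    rw [add_mul]
    exact h _ hm q s
  have hi : i ≤ (i + 1) * P := (Nat.le_succ i).trans (Nat.le_mul_of_pos_right _ hP)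
  -- A positive multiple of the period that is past the preperiod. The large factorials are of the
  -- same kind, so they give the same class.
  refine ⟨(i + 1) * P, by positivity, fun k hk s => ?_⟩
  obtain ⟨n, hn, hns⟩ := ((eventually_ge_atTop ((i + 1) * P)).and
    ((tendsto_omegaPow_map f s).eventually
      ((isOpen_level_eq c ((omegaPow (map f) s).1 c)).mem_nhds rfl))).exists
  obtain ⟨q, hq⟩ : P ∣ n.factorial :=
    Nat.dvd_factorial hP ((Nat.le_mul_of_pos_left P (Nat.succ_pos i)).trans hn)
  have hns' : ((map f)^[n.factorial] s).1 c = (omegaPow (map f) s).1 c := hns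
  have hle : i + 1 ≤ q := by
    have := hn.trans (Nat.self_le_factorial n)
    rw [hq, mul_comm P q] at this
    exact Nat.le_of_mul_le_mul_right this hP
  rw [← hns', hq, mul_comm P q, ← mul_assoc, h' _ _ hi hle,
    h' (i + 1) (k * (i + 1)) hi (Nat.le_mul_of_pos_left _ hk)]

end FreeProfiniteSemigroup

namespace Substitution

open FreeSemigroup (of letters)
open FreeProfiniteSemigroup

variable {A : Type u} {φ : Substitution A} {a b : A}

theorem language_factor {u v : FreeSemigroup A} (h : u * v ∈ φ.language) :
    u ∈ φ.language ∧ v ∈ φ.language := by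
  rw [mem_language_iff, FreeSemigroup.letters_mul] at h
  exact ⟨mem_language_iff.2 (mem_listLanguage_of_infix h (List.infix_append' [] _ _)),
    mem_language_iff.2 (mem_listLanguage_of_infix h ⟨letters u, [], by simp⟩)⟩

variable (φ) in
/-- The closure of the language in the free profinite semigroup. -/
def closedLanguage : Set (FreeProfiniteSemigroup A) := closure (ofWord '' φ.language)

theorem closedLanguage_factor {x y : FreeProfiniteSemigroup A} (h : x * y ∈ φ.closedLanguage) :
    x ∈ φ.closedLanguage ∧ y ∈ φ.closedLanguage :=
  mem_closure_of_mul_mem_closure (fun _ _ => language_factor) h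

theorem ofWord_mem_closedLanguage {w : FreeSemigroup A} (h : w ∈ φ.language) :
    ofWord w ∈ φ.closedLanguage := subset_closure ⟨w, h, rfl⟩

theorem iterate_mem_language {w : FreeSemigroup A} (h : w ∈ φ.language) (k : ℕ) :
    φ^[k] w ∈ φ.language := by
  rw [mem_language_iff, letters_iterate]
  exact iterate_onList_mem_listLanguage (mem_language_iff.1 h) k

/-- The standing assumptions: the substitution is weakly primitive, and the images of all letters
start with `a` and end with `b`. -/
structure IsProper (φ : Substitution A) (a b : A) : Prop where
  prim : φ.IsWeaklyPrimitive
  first : ∀ c : A, IsPrefixOf (of a) (φ (of c))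
  last : ∀ c : A, IsSuffixOf (of b) (φ (of c))

namespace IsProper

variable (hφ : IsProper φ a b)
include hφ

theorem pair_mem_language : of b * of a ∈ φ.language :=
  mem_language_iff.2 (pair_mem hφ.prim hφ.first hφ.last)

theorem left_mem_language : of a ∈ φ.language := (language_factor hφ.pair_mem_language).2

theorem right_mem_language : of b ∈ φ.language := (language_factor hφ.pair_mem_language).1

theorem exists_head (w : FreeSemigroup A) : ∃ t, (φ w).letters = a :: t := by
  rw [letters_apply]
  exact onList_head hφ.first w.letters_ne_nil

theorem exists_last (w : FreeSemigroup A) : ∃ t, (φ w).letters = t ++ [b] := by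
  rw [letters_apply]
  exact onList_last hφ.last w.letters_ne_nil

/-- The prefix `φᵐ(a)` of high iterates. -/
theorem exists_iterate_prefix (m : ℕ) : ∃ K, ∀ k, K ≤ k → ∀ w : FreeSemigroup A,
    ∃ y, φ^[k] w = φ^[m] (of a) * y := by
  obtain ⟨K, hK⟩ := hφ.prim.exists_length_le 2
  refine ⟨m + (K + 1), fun k hk w => ?_⟩
  obtain ⟨k, rfl⟩ := Nat.exists_eq_add_of_le hk
  obtain ⟨t, ht⟩ := hφ.exists_head (φ^[K + k] w)
  have hlen := hK (K + 1 + k) (by omega) w.letters w.letters_ne_nil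
  rw [← letters_iterate, show K + 1 + k = (K + k) + 1 by ring, Function.iterate_succ_apply', ht]
    at hlen
  obtain ⟨y, rfl⟩ := FreeSemigroup.exists_letters_eq (l := t) (by rintro rfl; simp at hlen)
  refine ⟨φ^[m] y, ?_⟩
  have hy : φ^[K + k + 1] w = of a * y := FreeSemigroup.letters_injective (by
    rw [Function.iterate_succ_apply', ht]; rfl)
  rw [show m + (K + 1) + k = m + (K + k + 1) by ring, Function.iterate_add_apply, hy]
  exact iterate_map_mul φ m _ _

theorem exists_iterate_suffix (m : ℕ) : ∃ K, ∀ k, K ≤ k → ∀ w : FreeSemigroup A,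
    ∃ y, φ^[k] w = y * φ^[m] (of b) := by
  obtain ⟨K, hK⟩ := hφ.prim.exists_length_le 2
  refine ⟨m + (K + 1), fun k hk w => ?_⟩
  obtain ⟨k, rfl⟩ := Nat.exists_eq_add_of_le hk
  obtain ⟨t, ht⟩ := hφ.exists_last (φ^[K + k] w)
  have hlen := hK (K + 1 + k) (by omega) w.letters w.letters_ne_nil
  rw [← letters_iterate, show K + 1 + k = (K + k) + 1 by ring, Function.iterate_succ_apply', ht]
    at hlen
  obtain ⟨y, rfl⟩ := FreeSemigroup.exists_letters_eq (l := t) (by rintro rfl; simp at hlen)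
  refine ⟨φ^[m] y, ?_⟩
  have hy : φ^[K + k + 1] w = y * of b := FreeSemigroup.letters_injective (by
    rw [Function.iterate_succ_apply', ht]; rfl)
  rw [show m + (K + 1) + k = m + (K + k + 1) by ring, Function.iterate_add_apply, hy]
  exact iterate_map_mul φ m _ _

end IsProper

/-! ### The group `G(φ)` -/

section Omega

variable {A : Type u} [Finite A] (φ : Substitution A)

theorem omega_apply (c : FiniteIndexCon A) : ∃ M : ℕ, 0 < M ∧ ∀ k, 0 < k →
    ∀ s : FreeProfiniteSemigroup A, (φ.omega s).1 c = ((FreeProfiniteSemigroup.map φ)^[k * M] s).1 c :=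
  omegaPow_map_apply φ c

theorem omega_mul (x y : FreeProfiniteSemigroup A) : φ.omega (x * y) = φ.omega x * φ.omega y := by
  ext c
  obtain ⟨M, -, h⟩ := φ.omega_apply c
  rw [mul_apply, h 1 one_pos, h 1 one_pos, h 1 one_pos, iterate_map_mul, mul_apply]

theorem omega_iterate_map (n : ℕ) (s : FreeProfiniteSemigroup A) :
    φ.omega ((FreeProfiniteSemigroup.map φ)^[n] s) = (FreeProfiniteSemigroup.map φ)^[n] (φ.omega s) := by
  refine tendsto_nhds_unique (tendsto_omegaPow_map φ _) ?_
  refine (((continuous_iterate_map φ n).tendsto _).comp (tendsto_omegaPow_map φ s)).congr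
    fun k => ?_
  simp only [Function.comp_apply]
  rw [← Function.iterate_add_apply, ← Function.iterate_add_apply, add_comm]

theorem omega_omega (s : FreeProfiniteSemigroup A) : φ.omega (φ.omega s) = φ.omega s := by
  ext c
  obtain ⟨M, -, h⟩ := φ.omega_apply c
  rw [h 1 one_pos, ← omega_iterate_map, h 1 one_pos, h 2 two_pos, ← Function.iterate_add_apply,
    ← add_mul]

theorem omega_mem_of_forall {T : Set (FreeProfiniteSemigroup A)} (hT : IsClosed T)
    {s : FreeProfiniteSemigroup A} (K : ℕ) (h : ∀ k, K ≤ k → (FreeProfiniteSemigroup.map φ)^[k] s ∈ T) :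
    φ.omega s ∈ T := by
  refine hT.mem_of_tendsto (tendsto_omegaPow_map φ s) ?_
  filter_upwards [eventually_ge_atTop K] with n hn
  exact h _ (hn.trans (Nat.self_le_factorial n))

end Omega

variable [Finite A]

theorem omega_ofWord_mem_closedLanguage {w : FreeSemigroup A} (h : w ∈ φ.language) :
    φ.omega (ofWord w) ∈ φ.closedLanguage := by
  refine φ.omega_mem_of_forall isClosed_closure 0 fun k _ => ?_
  rw [iterate_map_ofWord]
  exact ofWord_mem_closedLanguage (iterate_mem_language h k)

namespace IsProper

variable (hφ : IsProper φ a b)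
include hφ

/-- The elements of the closure of the language are factors of the elements `φ^ω(c)`. -/
theorem exists_factor {s : FreeProfiniteSemigroup A} (hs : s ∈ φ.closedLanguage) (c : A) :
    ∃ x y, x * s * y = φ.omega (ofWord (of c)) := by
  have : Nonempty A := ⟨a⟩
  -- The factors of a given element form a closed set, so words of the language suffice. Such a word
  -- is extended first, so that the cofactors are nonempty.
  refine closure_minimal (t := {s | ∃ x y, x * s * y = φ.omega (ofWord (of c))}) ?_
    (isClosed_factors _) hs
  rintro _ ⟨w, hw, rfl⟩
  obtain ⟨x, y, hx, hy, hm⟩ := hφ.prim.exists_extension (mem_language_iff.1 hw)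
  obtain ⟨K, hK⟩ := hm
  refine φ.omega_mem_of_forall (isClosed_multiples _) K fun k hk => ?_
  obtain ⟨s, t, hst⟩ := hK k hk c
  obtain ⟨u, hu⟩ := FreeSemigroup.exists_letters_eq (l := s ++ x) (by simp [hx])
  obtain ⟨v, hv⟩ := FreeSemigroup.exists_letters_eq (l := y ++ t) (by simp [hy])
  refine ⟨ofWord u, ofWord v, ?_⟩
  rw [iterate_map_ofWord, ← map_mul, ← map_mul]
  congr 1
  apply FreeSemigroup.letters_injective
  rw [letters_iterate, FreeSemigroup.letters_of, ← hst]
  simp [hu, hv]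

theorem omega_prefix_iterate (m : ℕ) (w : FreeSemigroup A) :
    ∃ y, φ.omega (ofWord w) = ofWord (φ^[m] (of a)) * y := by
  obtain ⟨K, hK⟩ := hφ.exists_iterate_prefix m
  refine φ.omega_mem_of_forall (isClosed_mul_left _) K fun k hk => ?_
  obtain ⟨y, hy⟩ := hK k hk w
  exact ⟨ofWord y, by rw [iterate_map_ofWord, hy, map_mul]⟩

theorem omega_suffix_iterate (m : ℕ) (w : FreeSemigroup A) :
    ∃ y, φ.omega (ofWord w) = y * ofWord (φ^[m] (of b)) := by
  obtain ⟨K, hK⟩ := hφ.exists_iterate_suffix m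
  refine φ.omega_mem_of_forall (isClosed_mul_right _) K fun k hk => ?_
  obtain ⟨y, hy⟩ := hK k hk w
  exact ⟨ofWord y, by rw [iterate_map_ofWord, hy, map_mul]⟩

/-- Apply the idempotent `φ^ω` to a factorization `φ^ω(w) = a y`. -/
theorem omega_prefix (w : FreeSemigroup A) :
    ∃ y, φ.omega (ofWord w) = φ.omega (ofWord (of a)) * y := by
  obtain ⟨y, hy⟩ := hφ.omega_prefix_iterate 0 w
  exact ⟨φ.omega y, by rw [← omega_omega, hy, omega_mul]; rfl⟩

theorem omega_suffix (w : FreeSemigroup A) :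
    ∃ y, φ.omega (ofWord w) = y * φ.omega (ofWord (of b)) := by
  obtain ⟨y, hy⟩ := hφ.omega_suffix_iterate 0 w
  exact ⟨φ.omega y, by rw [← omega_omega, hy, omega_mul]; rfl⟩

end IsProper

theorem isPrefixOf_iff {S : Type*} [Semigroup S] {s t : S} :
    IsPrefixOf s t ↔ t = s ∨ ∃ y, t = s * y := by
  constructor
  · rintro ⟨y, hy⟩
    revert hy
    refine WithOne.cases_on y (fun h => Or.inl ?_) fun y h => Or.inr ⟨y, ?_⟩
    · exact WithOne.coe_injective (by simpa using h)
    · exact WithOne.coe_injective (by simpa using h)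
  · rintro (rfl | ⟨y, rfl⟩)
    · exact ⟨1, (mul_one _).symm⟩
    · exact ⟨y, rfl⟩

theorem isSuffixOf_iff {S : Type*} [Semigroup S] {s t : S} :
    IsSuffixOf s t ↔ t = s ∨ ∃ y, t = y * s := by
  constructor
  · rintro ⟨y, hy⟩
    revert hy
    refine WithOne.cases_on y (fun h => Or.inl ?_) fun y h => Or.inr ⟨y, ?_⟩
    · exact WithOne.coe_injective (by simpa using h)
    · exact WithOne.coe_injective (by simpa using h)
  · rintro (rfl | ⟨y, rfl⟩)
    · exact ⟨1, (one_mul _).symm⟩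
    · exact ⟨y, rfl⟩

/-! ### Green's relations and the group structure on `G(φ)` -/

namespace IsProper

variable (hφ : IsProper φ a b)
include hφ

/-- The membership criterion for `G(φ)`. -/
theorem mem_group {s u v : FreeProfiniteSemigroup A} (hs : s ∈ φ.closedLanguage)
    (hu : s = φ.omega (ofWord (of a)) * u) (hv : s = v * φ.omega (ofWord (of b))) :
    s ∈ φ.schutzenbergerGroup a b := by
  constructor
  · obtain ⟨x, y, h⟩ := hφ.exists_factor hs a
    rw [hu] at h
    obtain ⟨z, hz⟩ := stable_right h
    exact ⟨isPrefixOf_iff.2 (Or.inr ⟨z, hu ▸ hz⟩), isPrefixOf_iff.2 (Or.inr ⟨u, hu⟩)⟩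
  · obtain ⟨x, y, h⟩ := hφ.exists_factor hs b
    rw [hv] at h
    obtain ⟨z, hz⟩ := stable_left h
    exact ⟨isSuffixOf_iff.2 (Or.inr ⟨z, hv ▸ hz⟩), isSuffixOf_iff.2 (Or.inr ⟨v, hv⟩)⟩

/-- `φ^ω(b) φ^ω(a) = φ^ω(ba)` is in the closure of the language, hence a factor of `φ^ω(a)`, and
stability applies. -/
theorem left_eq_mul : ∃ y, φ.omega (ofWord (of a)) =
    y * (φ.omega (ofWord (of b)) * φ.omega (ofWord (of a))) := by
  obtain ⟨x, y, h⟩ := hφ.exists_factor (omega_ofWord_mem_closedLanguage hφ.pair_mem_language) a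
  rw [map_mul, omega_mul] at h
  exact stable_left h

theorem right_eq_mul : ∃ y, φ.omega (ofWord (of b)) =
    φ.omega (ofWord (of b)) * φ.omega (ofWord (of a)) * y := by
  obtain ⟨x, y, h⟩ := hφ.exists_factor (omega_ofWord_mem_closedLanguage hφ.pair_mem_language) b
  rw [map_mul, omega_mul] at h
  exact stable_right h

/-- The elements of `G(φ)` are multiples of `φ^ω(a)` and `φ^ω(b)`, and conversely. -/
theorem mem_group_iff {s : FreeProfiniteSemigroup A} : s ∈ φ.schutzenbergerGroup a b ↔
    (∃ u, s = φ.omega (ofWord (of a)) * u) ∧ (∃ z, φ.omega (ofWord (of a)) = s * z) ∧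
    (∃ v, s = v * φ.omega (ofWord (of b))) ∧ ∃ z, φ.omega (ofWord (of b)) = z * s := by
  set p := φ.omega (ofWord (of a)) with hp
  set q := φ.omega (ofWord (of b)) with hq
  obtain ⟨p₁, hp₁⟩ := hφ.left_eq_mul
  obtain ⟨q₁, hq₁⟩ := hφ.right_eq_mul
  obtain ⟨p₂, hp₂⟩ := hφ.omega_suffix (of a)
  obtain ⟨q₂, hq₂⟩ := hφ.omega_prefix (of b)
  -- This and `hqq` absorb the trivial case of Green's relations, where the cofactor is the adjoined
  -- identity.
  have hpp : ∃ z, p = p * z := by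
    have : p = p₁ * (q * p * q₁ * p) := by rw [← hq₁]; exact hp₁
    refine ⟨q₁ * p, ?_⟩
    calc p = p₁ * (q * p * q₁ * p) := this
      _ = p₁ * (q * p) * (q₁ * p) := by simp only [mul_assoc]
      _ = p * (q₁ * p) := by rw [← hp₁]
  have hqq : ∃ z, q = z * q := by
    have : q = q * (p₁ * (q * p)) * q₁ := by rw [← hp₁]; exact hq₁
    refine ⟨q * p₁, ?_⟩
    calc q = q * (p₁ * (q * p)) * q₁ := this
      _ = q * p₁ * (q * p * q₁) := by simp only [mul_assoc]
      _ = q * p₁ * q := by rw [← hq₁]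
  constructor
  · rintro ⟨⟨h1, h2⟩, h3, h4⟩
    rw [isPrefixOf_iff] at h1 h2
    rw [isSuffixOf_iff] at h3 h4
    refine ⟨?_, ?_, ?_, ?_⟩
    · rcases h2 with rfl | h2
      · exact hpp
      · exact h2
    · rcases h1 with h1 | h1
      · rw [← h1]; exact hpp
      · exact h1
    · rcases h4 with rfl | h4
      · exact hqq
      · exact h4
    · rcases h3 with h3 | h3
      · rw [← h3]; exact hqq
      · exact h3
  · rintro ⟨h1, h2, h3, h4⟩
    exact ⟨⟨isPrefixOf_iff.2 (Or.inr h2), isPrefixOf_iff.2 (Or.inr h1)⟩,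
      isSuffixOf_iff.2 (Or.inr h4), isSuffixOf_iff.2 (Or.inr h3)⟩

theorem group_subset_closedLanguage : φ.schutzenbergerGroup a b ⊆ φ.closedLanguage := by
  intro s hs
  obtain ⟨-, ⟨z, hz⟩, -⟩ := hφ.mem_group_iff.1 hs
  have := omega_ofWord_mem_closedLanguage hφ.left_mem_language
  rw [hz] at this
  exact (closedLanguage_factor this).1

theorem omega_mem_group {w : FreeSemigroup A} (hw : w ∈ φ.language) :
    φ.omega (ofWord w) ∈ φ.schutzenbergerGroup a b := by
  obtain ⟨u, hu⟩ := hφ.omega_prefix w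
  obtain ⟨v, hv⟩ := hφ.omega_suffix w
  exact hφ.mem_group (omega_ofWord_mem_closedLanguage hw) hu hv

/-- Where `s` and `t` meet, the product contains `qp`, and `left_eq_mul` and `right_eq_mul` allow
passing from `qp` back to `p` or `q`. So no class is left. -/
theorem mul_mem_group {s t : FreeProfiniteSemigroup A} (hs : s ∈ φ.schutzenbergerGroup a b)
    (ht : t ∈ φ.schutzenbergerGroup a b) : s * t ∈ φ.schutzenbergerGroup a b := by
  rw [hφ.mem_group_iff] at hs ht ⊢
  obtain ⟨p₁, hp₁⟩ := hφ.left_eq_mul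
  obtain ⟨q₁, hq₁⟩ := hφ.right_eq_mul
  set p := φ.omega (ofWord (of a)) with hp
  set q := φ.omega (ofWord (of b)) with hq
  obtain ⟨⟨s1, hs1⟩, ⟨s2, hs2⟩, ⟨s3, hs3⟩, ⟨s4, hs4⟩⟩ := hs
  obtain ⟨⟨t1, ht1⟩, ⟨t2, ht2⟩, ⟨t3, ht3⟩, ⟨t4, ht4⟩⟩ := ht
  refine ⟨⟨s1 * t, by rw [← mul_assoc, ← hs1]⟩, ⟨t2 * q₁ * s2, ?_⟩,
    ⟨s * t3, by rw [mul_assoc, ← ht3]⟩, ⟨t4 * p₁ * s4, ?_⟩⟩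
  · calc p = s * s2 := hs2
      _ = s3 * q * s2 := by rw [← hs3]
      _ = s3 * (q * p * q₁) * s2 := by rw [← hq₁]
      _ = (s3 * q) * p * q₁ * s2 := by simp only [mul_assoc]
      _ = s * (t * t2) * q₁ * s2 := by rw [← hs3, ← ht2]
      _ = s * t * (t2 * q₁ * s2) := by simp only [mul_assoc]
  · calc q = t4 * t := ht4
      _ = t4 * (p * t1) := by rw [← ht1]
      _ = t4 * (p₁ * (q * p) * t1) := by rw [← hp₁]
      _ = t4 * p₁ * q * (p * t1) := by simp only [mul_assoc]
      _ = t4 * p₁ * (s4 * s) * t := by rw [← ht1, ← hs4]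
      _ = t4 * p₁ * s4 * (s * t) := by simp only [mul_assoc]

/-- By `mem_group`, two of the four divisibility conditions are automatic inside the closed
language; the other two are closed. -/
theorem isClosed_group : IsClosed (φ.schutzenbergerGroup a b) := by
  set p := φ.omega (ofWord (of a)) with hp
  set q := φ.omega (ofWord (of b)) with hq
  have : φ.schutzenbergerGroup a b = φ.closedLanguage ∩ {s | ∃ y, s = p * y} ∩
      {s | ∃ y, s = y * q} := by
    ext s
    constructor
    · intro hs
      obtain ⟨h1, -, h2, -⟩ := hφ.mem_group_iff.1 hs
      exact ⟨⟨hφ.group_subset_closedLanguage hs, h1⟩, h2⟩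
    · rintro ⟨⟨h1, u, hu⟩, v, hv⟩
      exact hφ.mem_group h1 hu hv
  rw [this]
  exact (isClosed_closure.inter (isClosed_mul_left p)).inter (isClosed_mul_right q)

/-- The idempotent of `G(φ)`. -/
theorem exists_group_one : ∃ e ∈ φ.schutzenbergerGroup a b, e * e = e ∧
    (∀ s ∈ φ.schutzenbergerGroup a b, e * s = s ∧ s * e = s) ∧
    ∀ s ∈ φ.schutzenbergerGroup a b, ∃ t ∈ φ.schutzenbergerGroup a b, t * s = e := by
  obtain ⟨e, he, hee⟩ := exists_idempotent_in_compact_subsemigroup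
    (fun r => continuous_mul_const r) (φ.schutzenbergerGroup a b)
    ⟨_, hφ.omega_mem_group hφ.left_mem_language⟩ hφ.isClosed_group.isCompact
    fun s hs t ht => hφ.mul_mem_group hs ht
  obtain ⟨⟨e1, he1⟩, ⟨e2, he2⟩, ⟨e3, he3⟩, ⟨e4, he4⟩⟩ := hφ.mem_group_iff.1 he
  have hes : ∀ s ∈ φ.schutzenbergerGroup a b, e * s = s := by
    intro s hs
    obtain ⟨⟨s1, hs1⟩, -⟩ := hφ.mem_group_iff.1 hs
    rw [hs1, he2, ← mul_assoc, ← mul_assoc, hee]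
  have hse : ∀ s ∈ φ.schutzenbergerGroup a b, s * e = s := by
    intro s hs
    obtain ⟨-, -, ⟨s1, hs1⟩, -⟩ := hφ.mem_group_iff.1 hs
    rw [hs1, he4, mul_assoc, mul_assoc, hee]
  refine ⟨e, he, hee, fun s hs => ⟨hes s hs, hse s hs⟩, fun s hs => ?_⟩
  obtain ⟨-, ⟨s2, hs2⟩, -, ⟨s4, hs4⟩⟩ := hφ.mem_group_iff.1 hs
  -- a left inverse `l` and a right inverse `r` in `eSe`
  have hl : e * (e3 * s4) * e * s = e := by
    rw [mul_assoc _ e s, hes s hs, mul_assoc, mul_assoc, ← hs4, ← he3, hee]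
  have hr : s * (e * (s2 * e1) * e) = e := by
    rw [← mul_assoc, ← mul_assoc, hse s hs, ← mul_assoc, ← hs2, ← he1, hee]
  have hlr : e * (e3 * s4) * e = e * (s2 * e1) * e := by
    calc e * (e3 * s4) * e = e * (e3 * s4) * (e * e) := by rw [hee]
      _ = e * (e3 * s4) * e * (s * (e * (s2 * e1) * e)) := by rw [hr]; simp only [mul_assoc]
      _ = e * (e3 * s4) * e * s * (e * (s2 * e1) * e) := by simp only [mul_assoc]
      _ = e * (e * (s2 * e1) * e) := by rw [hl]
      _ = e * e * (s2 * e1) * e := by simp only [mul_assoc]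
      _ = e * (s2 * e1) * e := by rw [hee]
  refine ⟨_, ?_, hl⟩
  rw [hφ.mem_group_iff]
  refine ⟨⟨e1 * ((e3 * s4) * e), ?_⟩, ⟨s * e2, ?_⟩, ⟨e * (e3 * s4) * e3, ?_⟩, ⟨e4 * s, ?_⟩⟩
  · rw [← mul_assoc (φ.omega (ofWord (of a))) e1, ← he1, mul_assoc]
  · rw [← mul_assoc, hl, ← he2]
  · rw [mul_assoc _ e3, ← he3]
  · rw [hlr, mul_assoc, hr, ← he4]

end IsProper

end Substitution

/-! ### Bounded delay and synchronization -/

theorem concatWords_eq {A : Type u} (us : List (FreeSemigroup A)) :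
    concatWords us = FreeMonoid.ofList (us.flatMap FreeSemigroup.letters) := by
  induction us with
  | nil => rfl
  | cons u us ih =>
    rw [List.flatMap_cons, FreeMonoid.ofList_append, ← ih, ← FreeSemigroup.toFreeMonoid_eq]
    rfl

theorem flatMap_letters_eq_nil {A : Type u} {us : List (FreeSemigroup A)}
    (h : us.flatMap FreeSemigroup.letters = []) : us = [] := by
  cases us with
  | nil => rfl
  | cons u us =>
    rw [List.flatMap_cons, List.append_eq_nil_iff] at h
    exact absurd h.1 u.letters_ne_nil

/-- The two sides of a reducible equality have a common proper nonempty prefix that is a product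
of factors on both sides. -/
theorem IsReducibleEquality.exists_take {A : Type u} {us vs : List (FreeSemigroup A)}
    (h : IsReducibleEquality us vs)
    (heq : us.flatMap FreeSemigroup.letters = vs.flatMap FreeSemigroup.letters) :
    ∃ i j, 0 < i ∧ i < us.length ∧ 0 < j ∧ j < vs.length ∧
      (us.take i).flatMap FreeSemigroup.letters = (vs.take j).flatMap FreeSemigroup.letters := by
  obtain ⟨r, s, hr, hr', hs, hs', h2, -, h⟩ := h
  rw [concatWords_eq, concatWords_eq] at h
  have h' := FreeMonoid.ofList.injective h
  have ht : (us.take (r - 1)).flatMap FreeSemigroup.letters =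
      (vs.take (s - 1)).flatMap FreeSemigroup.letters := by
    rw [← List.take_append_drop (r - 1) us, ← List.take_append_drop (s - 1) vs,
      List.flatMap_append, List.flatMap_append, h'] at heq
    exact List.append_cancel_right heq
  refine ⟨r - 1, s - 1, ?_, by omega, ?_, by omega, ht⟩
  -- Were one index `0`, both prefixes would be empty and both indices `0`, against `2 < r + s`.
  · by_contra h0
    have h0 : r - 1 = 0 := by omega
    rw [h0, List.take_zero, List.flatMap_nil] at ht
    have := congrArg List.length (flatMap_letters_eq_nil ht.symm)
    rw [List.length_take, List.length_nil] at this
    omega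
  · by_contra h0
    have h0 : s - 1 = 0 := by omega
    rw [h0, List.take_zero, List.flatMap_nil] at ht
    have := congrArg List.length (flatMap_letters_eq_nil ht)
    rw [List.length_take, List.length_nil] at this
    omega

namespace Substitution

open FreeSemigroup (of letters)
open FreeProfiniteSemigroup

variable {A : Type u} {φ : Substitution A} {a b : A}

theorem flatMap_letters_map (l : List A) :
    (l.map fun c => φ (of c)).flatMap letters = φ.onList l := by
  simp [onList, List.flatMap_map]

namespace IsProper

section Interior

variable (hφ : IsProper φ a b)
include hφ

theorem exists_interior {w : FreeSemigroup A} (hw : w ∈ φ.language) :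
    ∃ K, ∀ k, K ≤ k → ∀ c : A, ∃ x y, φ^[k] (of c) = x * w * y := by
  have : Nonempty A := ⟨a⟩
  obtain ⟨x, y, hx, hy, K, hK⟩ := hφ.prim.exists_extension (mem_language_iff.1 hw)
  refine ⟨K, fun k hk c => ?_⟩
  obtain ⟨s, t, hst⟩ := hK k hk c
  obtain ⟨u, hu⟩ := FreeSemigroup.exists_letters_eq (l := s ++ x) (by simp [hx])
  obtain ⟨v, hv⟩ := FreeSemigroup.exists_letters_eq (l := y ++ t) (by simp [hy])
  refine ⟨u, v, FreeSemigroup.letters_injective ?_⟩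
  rw [letters_iterate, FreeSemigroup.letters_of, ← hst]
  simp [hu, hv]

end Interior

variable [Finite A] (hφ : IsProper φ a b)
include hφ

/-- `φ^ω(a)` has the prefixes `φᴷ(a)` of unbounded length, followed by something nonempty, so it is
not a word. -/
theorem omega_left_mem_jClass : φ.omega (ofWord (of a)) ∈ φ.jClass := by
  refine ⟨omega_ofWord_mem_closedLanguage hφ.left_mem_language, ?_⟩
  rintro ⟨w, -, hw⟩
  obtain ⟨K, hK⟩ := hφ.prim.exists_length_le w.length
  obtain ⟨y, hy⟩ := hφ.omega_prefix_iterate K (of a)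
  obtain ⟨c, hc⟩ := FiniteIndexCon.exists_isolating (A := A) w.length
  obtain ⟨v, hv⟩ := y.exists_rep c
  have h1 : ((φ^[K] (of a) * v : FreeSemigroup A) : c.1.Quotient) = w := by
    rw [Con.coe_mul, ← hv]
    exact (congrArg (fun x => x.1 c) (hw.trans hy)).symm
  have h2 := congrArg FreeSemigroup.length (hc _ w le_rfl h1)
  have h3 := hK K le_rfl [a] (List.cons_ne_nil _ _)
  have h4 : (φ.onList^[K] [a]).length = (φ^[K] (of a)).length := by
    rw [← FreeSemigroup.letters_length, letters_iterate, FreeSemigroup.letters_of]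
  have h5 := List.length_pos_iff.2 v.letters_ne_nil
  rw [FreeSemigroup.letters_length] at h5
  rw [FreeSemigroup.length_mul] at h2
  omega

/-- This makes bounded delay, assumed for factors of `J(φ)`, available for the language. -/
theorem language_subset_factorsJ : φ.language ⊆ φ.factorsJ := by
  intro w hw
  obtain ⟨x, y, h⟩ := hφ.exists_factor (ofWord_mem_closedLanguage hw) a
  exact ⟨_, hφ.omega_left_mem_jClass, x, y, by rw [← h]; rfl⟩

/-- Synchronization: a long concatenation of words `φ(c)` inside of `φ(l)`, with `l` in the
language, has a cut in common with the factorization of `φ(l)`. -/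
theorem exists_cut (henc : φ.IsEncodingOfBoundedDelay) :
    ∃ N, ∀ l ∈ φ.listLanguage, ∀ α T β : List A, N ≤ T.length →
      φ.onList l = α ++ φ.onList T ++ β →
      ∃ l₁ l₂ T₁ T₂, l = l₁ ++ l₂ ∧ T = T₁ ++ T₂ ∧ φ.onList l₁ = α ++ φ.onList T₁ ∧
        φ.onList l₂ = φ.onList T₂ ++ β := by
  obtain ⟨N, hN⟩ := henc.2
  obtain ⟨M, hM⟩ : ∃ M, ∀ c, (letters (φ (of c))).length ≤ M := by
    obtain ⟨M, hM⟩ := (Set.finite_range fun c => (letters (φ (of c))).length).bddAbove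
    exact ⟨M, fun c => hM ⟨c, rfl⟩⟩
  -- `φ(T)` is at least as long as `T`, so it is longer than one block (`M`), and `T` alone supplies
  -- more than `N` code words.
  refine ⟨N + M + 1, fun l hl α T β hT heq => ?_⟩
  suffices H : ∃ l₁ l₂ T₁ T₂, l = l₁ ++ l₂ ∧ T = T₁ ++ T₂ ∧ φ.onList l₁ = α ++ φ.onList T₁ by
    obtain ⟨l₁, l₂, T₁, T₂, rfl, rfl, h⟩ := H
    refine ⟨l₁, l₂, T₁, T₂, rfl, rfl, h, ?_⟩
    rw [onList_append, onList_append, h] at heq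
    simpa using heq
  obtain ⟨l₁, c, l₂, c', l₃, s', s, p, p', rfl, hc, hs, hc', hp, rfl, hTs, -⟩ :=
    List.exists_decomposition_of_flatMap (fun c => letters (φ (of c))) hM heq.symm
      (by have := φ.length_le_onList T; omega)
  obtain ⟨u, rfl⟩ := FreeSemigroup.exists_letters_eq hs
  obtain ⟨v, rfl⟩ := FreeSemigroup.exists_letters_eq hp
  have hT0 : T ≠ [] := by rintro rfl; simp at hT
  obtain ⟨w, hw⟩ := FreeSemigroup.exists_letters_eq (φ.onList_ne_nil hT0)
  have hwL : w ∈ φ.factorsJ := hφ.language_subset_factorsJ (mem_language_iff.2 (by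
    rw [hw]
    exact mem_listLanguage_of_infix (onList_mem_listLanguage hl) ⟨_, _, heq.symm⟩))
  have e1 : (u :: (l₂.map fun c => φ (of c)) ++ [v]).flatMap letters = φ.onList T := by
    rw [List.cons_append, List.flatMap_cons, List.flatMap_append, flatMap_letters_map, hTs]
    simp [onList]
  have e2 : (T.map fun c => φ (of c)).flatMap letters = φ.onList T := flatMap_letters_map T
  have hred := (hN u v (l₂.map fun c => φ (of c)) (T.map fun c => φ (of c))
    ⟨_, ⟨c, rfl⟩, FreeSemigroup.isSuffixOf_iff.2 ⟨s', hc.symm⟩⟩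
    ⟨_, ⟨c', rfl⟩, FreeSemigroup.isPrefixOf_iff.2 ⟨p', hc'.symm⟩⟩
    (by simp) (by simp) (by simp only [List.length_map]; omega)).1 w hwL
    (by rw [concatWords_eq, e1, FreeSemigroup.toFreeMonoid_eq, hw])
    (by rw [concatWords_eq, e2, FreeSemigroup.toFreeMonoid_eq, hw])
  obtain ⟨i, j, hi, hi', hj, hj', ht⟩ := hred.exists_take (e1.trans e2.symm)
  obtain ⟨i, rfl⟩ := Nat.exists_eq_add_of_le' hi
  have hil : i ≤ (l₂.map fun c => φ (of c)).length := by
    simp only [List.cons_append, List.length_cons, List.length_append, List.length_nil] at hi'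
    omega
  rw [List.cons_append, List.take_succ_cons, List.take_append_of_le_length hil, List.flatMap_cons,
    ← List.map_take, ← List.map_take, flatMap_letters_map, flatMap_letters_map] at ht
  -- The common prefix consists of `u` and `i` complete images, and excludes `v`. So it ends at a
  -- boundary of the factorization of `φ(l)` as well as of `φ(T)`.
  refine ⟨l₁ ++ c :: l₂.take i, l₂.drop i ++ c' :: l₃, T.take j, T.drop j, ?_, by simp, ?_⟩
  · rw [List.append_assoc, List.cons_append, ← List.append_assoc (l₂.take i),
      List.take_append_drop]
  · rw [← ht, ← List.singleton_append, onList_append, onList_append, onList_singleton, hc]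
    simp [onList]

/-- The buffers `T` and `T'` each contain a common cut. Between the two cuts both factorizations
encode the same word, so injectivity of `φ` identifies the letters there. -/
theorem exists_sync (henc : φ.IsEncodingOfBoundedDelay) :
    ∃ N, ∀ l ∈ φ.listLanguage, ∀ α T y T' β : List A, N ≤ T.length → N ≤ T'.length →
      φ.onList l = α ++ φ.onList (T ++ y ++ T') ++ β →
      ∃ l₁ l₂, l = l₁ ++ y ++ l₂ ∧ φ.onList l₁ = α ++ φ.onList T ∧
        φ.onList l₂ = φ.onList T' ++ β := by
  obtain ⟨N, hN⟩ := hφ.exists_cut henc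
  refine ⟨N, fun l hl α T y T' β hT hT' heq => ?_⟩
  obtain ⟨l₁, m, T₁, T₂, rfl, rfl, h₁, hm⟩ :=
    hN l hl α T (φ.onList (y ++ T') ++ β) hT (by rw [heq]; simp)
  obtain ⟨m₁, m₂, T₃, T₄, rfl, rfl, h₃, h₄⟩ :=
    hN m (mem_listLanguage_of_infix hl ⟨l₁, [], by simp⟩) (φ.onList (T₂ ++ y)) T' β hT'
      (by rw [hm]; simp)
  rw [← onList_append] at h₃
  obtain rfl := φ.onList_injective henc.1 h₃
  exact ⟨l₁ ++ T₂, T₃ ++ m₂, by simp, by simp [h₁], by simp [h₄]⟩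

/-- Desubstitution of words of the language that have `φ^{m+1+j}(a)` as a prefix and
`φ^{m+1+j}(b)` as a suffix. -/
theorem exists_desubstitution (henc : φ.IsEncodingOfBoundedDelay) {j : ℕ}
    {x y x' y' : FreeSemigroup A} (ha : φ^[j] (of a) = x * of a * y)
    (hb : φ^[j] (of b) = x' * of b * y') :
    ∃ K, ∀ m, K ≤ m → ∀ v : FreeSemigroup A,
      φ^[m + 1 + j] (of a) * v * φ^[m + 1 + j] (of b) ∈ φ.language →
      ∃ k, φ^[m] (of a) * k * φ^[m] (of b) ∈ φ.language ∧
        φ (φ^[m] x * (φ^[m] (of a) * k * φ^[m] (of b)) * φ^[m] y') =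
          φ^[m + 1 + j] (of a) * v * φ^[m + 1 + j] (of b) := by
  have : Nonempty A := ⟨a⟩
  obtain ⟨N, hN⟩ := hφ.exists_sync henc
  obtain ⟨K, hK⟩ := hφ.prim.exists_length_le N
  refine ⟨K, fun m hm v hv => ?_⟩
  have hlen : ∀ z : FreeSemigroup A, N ≤ (φ^[m] z).letters.length := fun z => by
    rw [letters_iterate]; exact hK m hm _ z.letters_ne_nil
  -- The iterates `φᵐ(x)`, `φᵐ(y)` serve as synchronizing buffers around `φᵐ(a)`; in the same way
  -- `φᵐ(x')`, `φᵐ(y')` surround `φᵐ(b)`.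
  have ha' : (φ^[m + 1 + j] (of a)).letters =
      φ.onList ((φ^[m] x).letters ++ (φ^[m] (of a)).letters ++ (φ^[m] y).letters) := by
    rw [Function.iterate_add_apply, ha, add_comm m 1, Function.iterate_add_apply,
      Function.iterate_one, letters_apply, iterate_map_mul, iterate_map_mul]
    rfl
  have hb' : (φ^[m + 1 + j] (of b)).letters =
      φ.onList ((φ^[m] x').letters ++ (φ^[m] (of b)).letters ++ (φ^[m] y').letters) := by
    rw [Function.iterate_add_apply, hb, add_comm m 1, Function.iterate_add_apply,
      Function.iterate_one, letters_apply, iterate_map_mul, iterate_map_mul]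
    rfl
  rw [mem_language_iff, FreeSemigroup.letters_mul, FreeSemigroup.letters_mul, ha', hb'] at hv
  obtain ⟨l, hl, α, β, hαβ⟩ := hφ.prim.exists_infix_onList hv 1
  rw [Function.iterate_one] at hαβ
  obtain ⟨l₁, l₂, rfl, -, h₂⟩ := hN l hl α _ (φ^[m] (of a)).letters _ (v.letters ++ φ.onList ((φ^[m] x').letters ++
    (φ^[m] (of b)).letters ++ (φ^[m] y').letters) ++ β) (hlen x) (hlen y)
    (by rw [← hαβ]; simp only [List.append_assoc])
  obtain ⟨l₃, l₄, rfl, h₃, h₄⟩ := hN l₂ (mem_listLanguage_of_infix hl ⟨l₁ ++ (φ^[m] (of a)).letters, [], by simp⟩)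
    (φ.onList (φ^[m] y).letters ++ v.letters) _ (φ^[m] (of b)).letters _ β (hlen x') (hlen y')
    (by rw [h₂]; simp only [List.append_assoc])
  have hl₃ : l₃ ≠ [] := by
    rintro rfl
    simp at h₃
    exact v.letters_ne_nil h₃.2.1
  obtain ⟨k, rfl⟩ := FreeSemigroup.exists_letters_eq hl₃
  refine ⟨k, ?_, FreeSemigroup.letters_injective ?_⟩
  · rw [mem_language_iff]
    exact mem_listLanguage_of_infix hl ⟨l₁, l₄, by simp⟩
  · simp only [letters_apply, FreeSemigroup.letters_mul, ha', hb', onList_append, h₃,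
      List.append_assoc]

end IsProper

theorem map_apply_congr (c : FiniteIndexCon A) {x y : FreeProfiniteSemigroup A}
    (h : x.1 (comapCon φ c) = y.1 (comapCon φ c)) :
    (FreeProfiniteSemigroup.map φ x).1 c = (FreeProfiniteSemigroup.map φ y).1 c := by
  obtain ⟨w, hw⟩ := x.exists_rep (comapCon φ c)
  rw [map_apply_of_rep φ x c w hw, map_apply_of_rep φ y c w (h ▸ hw)]

/-! ### Surjectivity of `φ` on `G(φ)` and approximation by return generators -/

namespace IsProper

variable [Finite A] (hφ : IsProper φ a b)
include hφ

/-- In `g = g t g`, with `t` the inverse of `g`, the first factor supplies the prefix and the last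
one the suffix, without overlap. -/
theorem exists_eq_mul_mul {g : FreeProfiniteSemigroup A} (hg : g ∈ φ.schutzenbergerGroup a b)
    (m : ℕ) : ∃ y, g = ofWord (φ^[m] (of a)) * y * ofWord (φ^[m] (of b)) := by
  obtain ⟨e, -, -, he, hinv⟩ := hφ.exists_group_one
  obtain ⟨t, -, ht⟩ := hinv g hg
  obtain ⟨⟨u, hu⟩, -, ⟨v, hv⟩, -⟩ := hφ.mem_group_iff.1 hg
  obtain ⟨p, hp⟩ := hφ.omega_prefix_iterate m (of a)
  obtain ⟨q, hq⟩ := hφ.omega_suffix_iterate m (of b)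
  refine ⟨p * u * t * v * q, ?_⟩
  calc g = g * (t * g) := by rw [ht, (he g hg).2]
    _ = φ.omega (ofWord (of a)) * u * (t * (v * φ.omega (ofWord (of b)))) := by rw [← hu, ← hv]
    _ = _ := by rw [hp, hq]; simp only [mul_assoc]

/-- A substitution that is an encoding of bounded delay maps `G(φ)` onto itself. -/
theorem exists_preimage (henc : φ.IsEncodingOfBoundedDelay) {g : FreeProfiniteSemigroup A}
    (hg : g ∈ φ.schutzenbergerGroup a b) :
    ∃ h ∈ φ.schutzenbergerGroup a b, FreeProfiniteSemigroup.map φ h = g := by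
  obtain ⟨K₁, hK₁⟩ := hφ.exists_interior hφ.left_mem_language
  obtain ⟨K₂, hK₂⟩ := hφ.exists_interior hφ.right_mem_language
  obtain ⟨x, y, hxy⟩ := hK₁ (max K₁ K₂) (le_max_left _ _) a
  obtain ⟨x', y', hxy'⟩ := hK₂ (max K₁ K₂) (le_max_right _ _) b
  set j := max K₁ K₂
  obtain ⟨K, hK⟩ := hφ.exists_desubstitution henc hxy hxy'
  set p := φ.omega (ofWord (of a)) with hp
  set q := φ.omega (ofWord (of b)) with hq
  let F : FreeProfiniteSemigroup A → FreeProfiniteSemigroup A := fun s =>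
    FreeProfiniteSemigroup.map φ (φ.omega (ofWord x) * (p * s * q) * φ.omega (ofWord y'))
  have hF : Continuous F := (continuous_map φ).comp (by fun_prop)
  -- The approximate solutions modulo `c`: the middle part looks like a word of the language and the
  -- image looks like `g`. Compactness yields a common solution for all `c`.
  let Y : FiniteIndexCon A → Set (FreeProfiniteSemigroup A) := fun c =>
    {s | (p * s * q).1 c ∈ (fun w : FreeSemigroup A => (w : c.1.Quotient)) '' φ.language} ∩
      {s | (F s).1 c ∈ ({g.1 c} : Set c.1.Quotient)}
  have hY : ∀ c, IsClosed (Y c) := by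
    have hcl : ∀ (c : FiniteIndexCon A) (T : Set c.1.Quotient),
        IsClosed {x : FreeProfiniteSemigroup A | x.1 c ∈ T} := fun c T =>
      ⟨isOpen_level c Tᶜ⟩
    intro c
    have hpq : Continuous fun s => p * s * q := by fun_prop
    exact IsClosed.inter
      ((hcl c ((fun w : FreeSemigroup A => (w : c.1.Quotient)) '' φ.language)).preimage hpq)
      ((hcl c {g.1 c}).preimage hF)
  have hmono : ∀ c d : FiniteIndexCon A, c.1 ≤ d.1 → Y c ⊆ Y d := by
    rintro c d hcd s ⟨⟨w, hw, hws⟩, hs⟩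
    exact ⟨⟨w, hw, ((p * s * q).2 c d hcd w hws.symm).symm⟩, val_eq_of_le hcd hs⟩
  have hne : ∀ c, (Y c).Nonempty := by
    intro c
    obtain ⟨M₁, hM₁, h₁⟩ := φ.omega_apply c
    obtain ⟨M₂, hM₂, h₂⟩ := φ.omega_apply (comapCon φ c)
    obtain ⟨m, hm, hm₁, hm₂⟩ : ∃ m, K ≤ m ∧
        (∀ w, (φ.omega (ofWord w)).1 c = (φ^[m] w : FreeSemigroup A)) ∧
        ∀ w, (φ.omega (ofWord w)).1 (comapCon φ c) = (φ^[m] w : FreeSemigroup A) := by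
      -- A common multiple of `M₁` and `M₂`, so that `φᵐ` represents `φ^ω` modulo both congruences,
      -- and at least `K`, so that desubstitution applies.
      refine ⟨(K + 1) * (M₁ * M₂), ?_, fun w => ?_, fun w => ?_⟩
      · exact (Nat.le_succ K).trans (Nat.le_mul_of_pos_right _ (by positivity))
      · rw [show (K + 1) * (M₁ * M₂) = (K + 1) * M₂ * M₁ by ring, h₁ ((K + 1) * M₂) (by positivity),
          iterate_map_ofWord, ofWord_apply]
      · rw [show (K + 1) * (M₁ * M₂) = (K + 1) * M₁ * M₂ by ring, h₂ ((K + 1) * M₁) (by positivity),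
          iterate_map_ofWord, ofWord_apply]
    obtain ⟨z, hz⟩ := hφ.exists_eq_mul_mul hg (m + 1 + j)
    obtain ⟨v, hv, hvz⟩ := exists_word_between (hz ▸ hφ.group_subset_closedLanguage hg) c
    obtain ⟨k, hk, hkW⟩ := hK m hm v hv
    refine ⟨ofWord k, ⟨_, hk, ?_⟩, ?_⟩
    · rw [mul_apply, mul_apply, hp, hq, hm₁, hm₁]
      rfl
    · have h3 : (φ.omega (ofWord x) * (p * ofWord k * q) * φ.omega (ofWord y')).1 (comapCon φ c) =
          (ofWord (φ^[m] x * (φ^[m] (of a) * k * φ^[m] (of b)) * φ^[m] y')).1 (comapCon φ c) := by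
        simp only [mul_apply, hp, hq, hm₂]
        rfl
      show (F (ofWord k)).1 c = g.1 c
      rw [map_apply_congr c h3, map_ofWord, hkW, hz, mul_apply, mul_apply, hvz]
      rfl
  have : Nonempty (FiniteIndexCon A) := ⟨(FiniteIndexCon.exists_isolating (A := A) 0).choose⟩
  obtain ⟨s, hs⟩ := IsCompact.nonempty_iInter_of_directed_nonempty_isCompact_isClosed Y
    (fun c d => ⟨c.inf d, hmono _ _ (c.inf_le_left d), hmono _ _ (c.inf_le_right d)⟩) hne
    (fun c => (hY c).isCompact) hY
  rw [Set.mem_iInter] at hs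
  have hsL : p * s * q ∈ φ.closedLanguage := mem_closure_iff_level.2 fun c => by
    obtain ⟨⟨w, hw, hws⟩, -⟩ := hs c
    exact ⟨_, ⟨w, hw, rfl⟩, hws⟩
  have hx : x ∈ φ.language := (language_factor (language_factor
    (hxy ▸ iterate_mem_language hφ.left_mem_language j)).1).1
  have hy' : y' ∈ φ.language := (language_factor
    (hxy' ▸ iterate_mem_language hφ.right_mem_language j)).2
  refine ⟨φ.omega (ofWord x) * (p * s * q) * φ.omega (ofWord y'), ?_,
    FreeProfiniteSemigroup.ext fun c => (hs c).2⟩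
  exact hφ.mul_mem_group (hφ.mul_mem_group (hφ.omega_mem_group hx)
    (hφ.mem_group hsL (by rw [mul_assoc]) rfl)) (hφ.omega_mem_group hy')

theorem exists_iterate_preimage (henc : φ.IsEncodingOfBoundedDelay) (n : ℕ)
    {g : FreeProfiniteSemigroup A} (hg : g ∈ φ.schutzenbergerGroup a b) :
    ∃ h ∈ φ.schutzenbergerGroup a b, (FreeProfiniteSemigroup.map φ)^[n] h = g := by
  induction n with
  | zero => exact ⟨g, hg, rfl⟩
  | succ n ih =>
    obtain ⟨h, hh, rfl⟩ := ih
    obtain ⟨h', hh', rfl⟩ := hφ.exists_preimage henc hh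
    exact ⟨h', hh', rfl⟩

/-- The elements of `G(φ)` are limits of elements `φ^ω(w)`, where `w` is a product of return
generators. -/
theorem exists_decode_approx (henc : φ.IsEncodingOfBoundedDelay) {g : FreeProfiniteSemigroup A}
    (hg : g ∈ φ.schutzenbergerGroup a b) (c : FiniteIndexCon A) :
    ∃ v, (φ.omega (ofWord (decode (φ.returnGenerators a b) v))).1 c = g.1 c := by
  obtain ⟨M, hM, h⟩ := φ.omega_apply c
  obtain ⟨N, hN⟩ := exists_decode_eq_iterate hφ.prim hφ.first hφ.last
  -- The inner `(N + 1) * M` iterations turn any word into a product of return generators; the outer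
  -- `M` represent `φ^ω` modulo `c`.
  obtain ⟨s, -, rfl⟩ := hφ.exists_iterate_preimage henc (M + (N + 1) * M) hg
  have hdense : ∃ w : FreeSemigroup A, ((FreeProfiniteSemigroup.map φ)^[M + (N + 1) * M]
      (ofWord w)).1 c = ((FreeProfiniteSemigroup.map φ)^[M + (N + 1) * M] s).1 c := by
    obtain ⟨w, hw⟩ := denseRange_ofWord.exists_mem_open
      ((isOpen_level_eq c (((FreeProfiniteSemigroup.map φ)^[M + (N + 1) * M] s).1 c)).preimage
        (continuous_iterate_map φ (M + (N + 1) * M))) ⟨s, rfl⟩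
    exact ⟨w, hw⟩
  obtain ⟨w, hw⟩ := hdense
  obtain ⟨v, hv⟩ := hN ((N + 1) * M)
    ((Nat.le_succ N).trans (Nat.le_mul_of_pos_right _ hM)) w
  refine ⟨v, ?_⟩
  rw [← hw, hv, h 1 one_pos, one_mul, iterate_map_ofWord, iterate_map_ofWord,
    Function.iterate_add_apply]

end IsProper

end Substitution

/-! ### Homomorphisms from free profinite groups -/

/-- The universal property of free profinite groups, for groups that are closed subsets of a
compact zero-dimensional semigroup. -/
theorem FreeProfiniteGroup.exists_hom {S X : Type u} [Semigroup S] [TopologicalSpace S]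
    [ContinuousMul S] [CompactSpace S] [T2Space S] [TotallyDisconnectedSpace S] {G : Set S}
    (hG : IsClosed G) (hmul : ∀ s ∈ G, ∀ t ∈ G, s * t ∈ G) {e : S} (he : e ∈ G)
    (hone : ∀ s ∈ G, e * s = s) (hinv : ∀ s ∈ G, ∃ t ∈ G, t * s = e) (f : X → S)
    (hf : ∀ x, f x ∈ G) :
    ∃ θ : FreeProfiniteGroup X → S, Continuous θ ∧ (∀ y z, θ (y * z) = θ y * θ z) ∧
      (∀ x, θ (FreeProfiniteGroup.gen x) = f x) ∧ ∀ y, θ y ∈ G := by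
  choose! i hiG hi using hinv
  let mulG : Mul G := ⟨fun s t => ⟨s.1 * t.1, hmul s s.2 t t.2⟩⟩
  let oneG : One G := ⟨⟨e, he⟩⟩
  let invG : Inv G := ⟨fun s => ⟨i s.1, hiG s s.2⟩⟩
  let groupG : Group G := Group.ofLeftAxioms
    (fun s t u => Subtype.ext (mul_assoc s.1 t.1 u.1))
    (fun s => Subtype.ext (hone s s.2)) (fun s => Subtype.ext (hi s s.2))
  have : CompactSpace G := isCompact_iff_compactSpace.1 hG.isCompact
  have contMul : ContinuousMul G :=
    ⟨Continuous.subtype_mk ((continuous_subtype_val.comp continuous_fst).mul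
      (continuous_subtype_val.comp continuous_snd)) _⟩
  -- The graph of inversion is a closed subset of a compact space, so preimages of closed sets are
  -- projections of compact sets.
  have contInv : ContinuousInv G := by
    refine ⟨continuous_iff_isClosed.2 fun C hC => ?_⟩
    have hK : IsCompact ({p : G × G | p.1 * p.2 = 1} ∩ Prod.snd ⁻¹' C) :=
      ((isClosed_eq continuous_mul continuous_const).inter (hC.preimage continuous_snd)).isCompact
    convert (hK.image continuous_fst).isClosed using 1
    ext s
    constructor
    · exact fun hs => ⟨(s, s⁻¹), ⟨mul_inv_cancel s, hs⟩, rfl⟩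
    · rintro ⟨⟨s, t⟩, ⟨hst, ht⟩, rfl⟩
      have hst' : s * t = 1 := hst
      rw [Set.mem_preimage, inv_eq_of_mul_eq_one_right hst']
      exact ht
  have : IsTopologicalGroup G := ⟨⟩
  let P : ProfiniteGrp.{u} := ProfiniteGrp.of G
  let h : FreeGroup X →* P := FreeGroup.lift fun x => (⟨f x, hf x⟩ : G)
  let L := ProfiniteGrp.ProfiniteCompletion.lift (P := P) (G := GrpCat.of (FreeGroup X))
    (GrpCat.ofHom h)
  refine ⟨fun y => ((L.hom y : G) : S), continuous_subtype_val.comp L.hom.continuous_toFun,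
    fun y z => ?_, fun x => ?_, fun y => (L.hom y : G).2⟩
  · exact congrArg Subtype.val (map_mul L.hom y z)
  · have hx := CategoryTheory.ConcreteCategory.congr_hom
      (ProfiniteGrp.ProfiniteCompletion.lift_eta (P := P) (G := GrpCat.of (FreeGroup X))
        (GrpCat.ofHom h)) (FreeGroup.of x)
    have hx' : L.hom (FreeProfiniteGroup.gen x) = h (FreeGroup.of x) := hx
    exact congrArg Subtype.val (hx'.trans FreeGroup.lift_apply_of)

instance FreeProfiniteSemigroup.totallySeparatedSpace {A : Type u} :
    TotallySeparatedSpace (FreeProfiniteSemigroup A) := by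
  refine totallySeparatedSpace_iff_exists_isClopen.2 fun x y hxy => ?_
  obtain ⟨c, hc⟩ : ∃ c, x.1 c ≠ y.1 c := by
    by_contra! h
    exact hxy (FreeProfiniteSemigroup.ext h)
  refine ⟨{z | z.1 c = x.1 c}, ⟨⟨?_⟩, isOpen_level_eq c _⟩, rfl, fun h => hc h.symm⟩
  exact isOpen_level c {x.1 c}ᶜ

namespace FreeProfiniteGroup

variable {X : Type u}

/-- The homomorphism from the free semigroup to the free profinite group. -/
noncomputable def ofPositive : FreeSemigroup X →ₙ* FreeProfiniteGroup X :=
  FreeSemigroup.lift gen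

theorem ofPositive_of (x : X) : ofPositive (FreeSemigroup.of x) = gen x := rfl

theorem ofPositive_eq (w : FreeSemigroup X) : ofPositive w =
    ProfiniteGrp.ProfiniteCompletion.etaFn (GrpCat.of (FreeGroup X))
      (FreeSemigroup.lift FreeGroup.of w) := by
  induction w using FreeSemigroup.recOnMul with
  | ih1 x => rfl
  | ih2 x w hx hw => rw [map_mul, map_mul, hx, hw]; rfl

theorem map_ofPositive (ψ : Substitution X) (w : FreeSemigroup X) :
    map ψ.toFreeGroupHom (ofPositive w) = ofPositive (ψ w) := by
  induction w using FreeSemigroup.recOnMul with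
  | ih1 x =>
    rw [ofPositive_eq, map_etaFn, ofPositive_eq, FreeSemigroup.lift_of]
    congr 1
    exact FreeGroup.lift_apply_of
  | ih2 x w hx hw => simp only [map_mul, hx, hw]

theorem iterate_map_ofPositive (ψ : Substitution X) (n : ℕ) (w : FreeSemigroup X) :
    (map ψ.toFreeGroupHom)^[n] (ofPositive w) = ofPositive (ψ^[n] w) := by
  induction n with
  | zero => rfl
  | succ n ih => rw [Function.iterate_succ_apply', Function.iterate_succ_apply', ih, map_ofPositive]

theorem isOpen_coset {U : Subgroup (FreeProfiniteGroup X)}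
    (hU : IsOpen (U : Set (FreeProfiniteGroup X))) (y : FreeProfiniteGroup X) :
    IsOpen {z | (QuotientGroup.mk z : FreeProfiniteGroup X ⧸ U) = QuotientGroup.mk y} := by
  have : {z | (QuotientGroup.mk z : FreeProfiniteGroup X ⧸ U) = QuotientGroup.mk y} =
      (fun z => y⁻¹ * z) ⁻¹' (U : Set (FreeProfiniteGroup X)) := by
    ext z
    exact eq_comm.trans QuotientGroup.eq
  rw [this]
  exact hU.preimage (continuous_const_mul _)

/-- The positive words are dense in a free profinite group. -/
theorem denseRange_ofPositive [Nonempty X] :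
    DenseRange (ofPositive : FreeSemigroup X → FreeProfiniteGroup X) := by
  intro y
  rw [mem_closure_iff]
  intro O hO hy
  obtain ⟨V, hV⟩ := ProfiniteGrp.exist_openNormalSubgroup_sub_open_nhds_of_one
    (U := (fun z => y * z) ⁻¹' O) (hO.preimage (continuous_const_mul y)) (by simpa using hy)
  let Q := FreeProfiniteGroup X ⧸ V.toSubgroup
  have : Finite Q := inferInstanceAs (Finite (FreeProfiniteGroup X ⧸ V.toOpenSubgroup.toSubgroup))
  let π : FreeProfiniteGroup X →* Q := QuotientGroup.mk' V.toSubgroup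
  have hT1 : ∀ q ∈ Set.range (fun w => π (ofPositive w)), ∀ n : ℕ,
      q ^ (n + 1) ∈ Set.range (fun w => π (ofPositive w)) := by
    rintro _ ⟨w, rfl⟩ n
    induction n with
    | zero => exact ⟨w, by simp⟩
    | succ n ih =>
      obtain ⟨v, hv⟩ := ih
      exact ⟨v * w, by rw [pow_succ, ← hv]; simp only [map_mul]⟩
  -- In a finite group, a nonempty subsemigroup contains `1` and inverses, since these are positive
  -- powers or, for the inverses, powers in the monoid already obtained.
  let T : Submonoid Q :=
    { carrier := Set.range fun w => π (ofPositive w)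
      mul_mem' := by
        rintro _ _ ⟨v, rfl⟩ ⟨w, rfl⟩
        exact ⟨v * w, by simp only [map_mul]⟩
      one_mem' := by
        have x : X := Classical.arbitrary X
        have h := hT1 _ ⟨FreeSemigroup.of x, rfl⟩ (Nat.card Q - 1)
        rwa [Nat.sub_add_cancel Nat.card_pos, pow_card_eq_one'] at h }
  have hTinv : ∀ q ∈ T, q⁻¹ ∈ T := by
    intro q hq
    have : q⁻¹ = q ^ (Nat.card Q - 1) := by
      rw [inv_eq_iff_mul_eq_one, ← pow_succ', Nat.sub_add_cancel Nat.card_pos, pow_card_eq_one']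
    rw [this]
    exact pow_mem hq _
  have hT : ∀ z : FreeGroup X,
      π (ProfiniteGrp.ProfiniteCompletion.etaFn (GrpCat.of (FreeGroup X)) z) ∈ T := by
    let ηh : FreeGroup X →* FreeProfiniteGroup X :=
      (ProfiniteGrp.ProfiniteCompletion.eta (GrpCat.of (FreeGroup X))).hom
    intro z
    change π (ηh z) ∈ T
    induction z using FreeGroup.induction_on with
    | C1 => rw [map_one, map_one]; exact T.one_mem
    | of x => exact ⟨FreeSemigroup.of x, rfl⟩
    | inv_of x hx => rw [map_inv, map_inv]; exact hTinv _ hx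
    | mul x y hx hy => rw [map_mul, map_mul]; exact T.mul_mem hx hy
  obtain ⟨z, hz⟩ := (ProfiniteGrp.ProfiniteCompletion.denseRange
    (GrpCat.of (FreeGroup X))).exists_mem_open (isOpen_coset V.isOpen' y) ⟨y, rfl⟩
  obtain ⟨w, hw⟩ := hT z
  refine ⟨ofPositive w, ?_, w, rfl⟩
  have hwy : (QuotientGroup.mk (ofPositive w) : Q) = QuotientGroup.mk y := hw.trans hz
  have := hV (QuotientGroup.eq.1 hwy.symm)
  simpa using this

/-- Closed normal subgroups are intersections of open normal subgroups. -/
theorem exists_open_normal_le {N : Subgroup (FreeProfiniteGroup X)} [N.Normal]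
    (hN : IsClosed (N : Set (FreeProfiniteGroup X))) {y : FreeProfiniteGroup X} (hy : y ∉ N) :
    ∃ U : Subgroup (FreeProfiniteGroup X), U.Normal ∧ IsOpen (U : Set (FreeProfiniteGroup X)) ∧
      N ≤ U ∧ y ∉ U := by
  obtain ⟨V, hV⟩ := ProfiniteGrp.exist_openNormalSubgroup_sub_open_nhds_of_one
    (U := (fun z => y * z) ⁻¹' (N : Set (FreeProfiniteGroup X))ᶜ)
    (hN.isOpen_compl.preimage (continuous_const_mul y)) (by simpa using hy)
  -- `V` is chosen such that the coset `yV` misses `N`; hence `y` is not in the open subgroup `NV`.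
  refine ⟨N ⊔ V.toSubgroup, inferInstance, ?_, le_sup_left, fun hyU => ?_⟩
  · exact Subgroup.isOpen_mono (H₁ := V.toSubgroup) le_sup_right V.isOpen'
  · obtain ⟨n, hn, v, hv, rfl⟩ := Subgroup.mem_sup_of_normal_right.1 hyU
    refine hV (V.toSubgroup.inv_mem hv) ?_
    simpa using hn

end FreeProfiniteGroup

/-! ### The presentation -/

namespace Substitution

open FreeSemigroup (of letters)
open FreeProfiniteSemigroup
open FreeProfiniteGroup (gen ofPositive)

variable {A : Type u} {φ : Substitution A} {a b : A}

theorem IsInducedBy.decode_iterate {X : Set (FreeSemigroup A)} {ψ : Substitution X}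
    (h : φ.IsInducedBy ψ) (n : ℕ) (w : FreeSemigroup X) :
    decode X (ψ^[n] w) = φ^[n] (decode X w) := by
  induction n with
  | zero => rfl
  | succ n ih =>
    rw [Function.iterate_succ_apply', Function.iterate_succ_apply', ← ih]
    exact DFunLike.congr_fun h _

/-! ### The kernel of the homomorphism given by `φ^ω` -/

section Kernel

variable {X : Set (FreeSemigroup A)} {θ : FreeProfiniteGroup X → FreeProfiniteSemigroup A}
  [Finite A]

theorem hom_ofPositive (hmul : ∀ y z, θ (y * z) = θ y * θ z)
    (hgen : ∀ x : X, θ (gen x) = φ.omega (ofWord (x : FreeSemigroup A))) (w : FreeSemigroup X) :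
    θ (ofPositive w) = φ.omega (ofWord (decode X w)) := by
  induction w using FreeSemigroup.recOnMul with
  | ih1 x => exact hgen x
  | ih2 x w hx hw => rw [map_mul, hmul, hx, hw, map_mul, map_mul, omega_mul]

/-- The relators are in the kernel of the homomorphism given by `φ^ω`. -/
theorem hom_eq_of_mem_relations [Finite X] (hcont : Continuous θ)
    (hmul : ∀ y z, θ (y * z) = θ y * θ z)
    (hgen : ∀ x : X, θ (gen x) = φ.omega (ofWord (x : FreeSemigroup A)))
    {ψ : Substitution X} (hψ : φ.IsInducedBy ψ) {y : FreeProfiniteGroup X}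
    (hy : y ∈ (Subgroup.normalClosure ψ.omegaRelators).topologicalClosure) : θ y = θ 1 := by
  have h11 : θ 1 * θ 1 = θ 1 := by rw [← hmul, one_mul]
  let K : Subgroup (FreeProfiniteGroup X) :=
    { carrier := {y | θ y = θ 1}
      mul_mem' := fun {y z} hy hz => by
        show θ (y * z) = θ 1
        rw [hmul, hy, hz, h11]
      one_mem' := rfl
      inv_mem' := fun {y} hy => by
        have hy' : θ y = θ 1 := hy
        show θ y⁻¹ = θ 1
        calc θ y⁻¹ = θ (y⁻¹ * 1) := by rw [mul_one]
          _ = θ 1 := by rw [hmul, ← hy', ← hmul, inv_mul_cancel, hy'] }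
  have hK : K.Normal := ⟨fun y hy g => by
    have hy' : θ y = θ 1 := hy
    show θ (g * y * g⁻¹) = θ 1
    rw [hmul, hmul, hy', ← hmul, ← hmul, mul_one, mul_inv_cancel]⟩
  have hrel : ψ.omegaRelators ⊆ (K : Set (FreeProfiniteGroup X)) := by
    rintro _ ⟨x, rfl⟩
    have hlim := (hcont.tendsto _).comp
      (FreeProfiniteGroup.tendsto_omegaPow_map ψ.toFreeGroupHom (gen x))
    have hlim' : Tendsto (fun n : ℕ => (FreeProfiniteSemigroup.map φ)^[n.factorial]
        (φ.omega (ofWord (x : FreeSemigroup A)))) atTop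
        (𝓝 (φ.omega (φ.omega (ofWord (x : FreeSemigroup A))))) := tendsto_omegaPow_map φ _
    -- `θ` carries the `n!`-th iterate at `x` to `φ^{n!}(φ^ω(x))`; both sides converge, and `φ^ω` is
    -- idempotent.
    have hx : θ (omegaPow (FreeProfiniteGroup.map ψ.toFreeGroupHom) (gen x)) = θ (gen x) := by
      rw [hgen, ← omega_omega]
      refine tendsto_nhds_unique hlim (hlim'.congr fun n => ?_)
      rw [Function.comp_apply, ← FreeProfiniteGroup.ofPositive_of,
        FreeProfiniteGroup.iterate_map_ofPositive, hom_ofPositive hmul hgen, hψ.decode_iterate,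
        ← omega_iterate_map, iterate_map_ofWord]
      rfl
    show θ (_ * _) = θ 1
    rw [hmul, hx, ← hmul, mul_inv_cancel]
  exact Subgroup.topologicalClosure_minimal _ (Subgroup.normalClosure_le_normal hrel)
    (isClosed_eq hcont continuous_const) hy

/-- The kernel of the homomorphism given by `φ^ω` is contained in the closed normal subgroup
generated by the relators. -/
theorem mem_relations_of_hom_eq [Nonempty X] (hX : ∀ x ∈ X, IsBlock a b x.letters)
    (hfin : X.Finite) (hcont : Continuous θ) (hmul : ∀ y z, θ (y * z) = θ y * θ z)
    (hgen : ∀ x : X, θ (gen x) = φ.omega (ofWord (x : FreeSemigroup A)))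
    {ψ : Substitution X} (hψ : φ.IsInducedBy ψ) {y : FreeProfiniteGroup X} (hy : θ y = θ 1) :
    y ∈ (Subgroup.normalClosure ψ.omegaRelators).topologicalClosure := by
  have : Finite X := hfin
  by_contra hyN
  obtain ⟨U, hU, hUo, hNU, hyU⟩ := FreeProfiniteGroup.exists_open_normal_le
    (Subgroup.isClosed_topologicalClosure _) hyN
  let H := FreeProfiniteGroup X ⧸ U
  have : Finite H := Subgroup.quotient_finite_of_isOpen U hUo
  let χ : FreeProfiniteGroup X →* H := QuotientGroup.mk' U
  have hχo : ∀ z, IsOpen {z' | χ z' = χ z} := FreeProfiniteGroup.isOpen_coset hUo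
  -- some iterate of the induced endomorphism is compatible with `χ`
  have hev : ∀ᶠ n : ℕ in atTop, ∀ x : X,
      χ ((FreeProfiniteGroup.map ψ.toFreeGroupHom)^[n.factorial] (gen x)) = χ (gen x) := by
    rw [eventually_all]
    intro x
    have hx : χ (omegaPow (FreeProfiniteGroup.map ψ.toFreeGroupHom) (gen x)) = χ (gen x) := by
      rw [← mul_inv_eq_one, ← map_inv, ← map_mul]
      exact (QuotientGroup.eq_one_iff _).2 (hNU (Subgroup.le_topologicalClosure _
        (Subgroup.subset_normalClosure ⟨x, rfl⟩)))
    filter_upwards [(FreeProfiniteGroup.tendsto_omegaPow_map ψ.toFreeGroupHom (gen x)).eventually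
      ((hχo _).mem_nhds rfl)] with n hn
    exact Eq.trans hn hx
  obtain ⟨c, hc⟩ := exists_finiteIndexCon_decode hX hfin fun x => χ (gen x)
  have hlift : ∀ w, FreeSemigroup.lift (fun x => χ (gen x)) w = χ (ofPositive w) := by
    intro w
    induction w using FreeSemigroup.recOnMul with
    | ih1 x => rfl
    | ih2 x w hx hw => rw [map_mul, map_mul, map_mul, hx, hw]
  obtain ⟨M, hM, hω⟩ := φ.omega_apply c
  obtain ⟨n, hn, hnM⟩ := (hev.and (eventually_ge_atTop M)).exists
  obtain ⟨k, hk⟩ := Nat.dvd_factorial hM hnM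
  have hk0 : 0 < k := by
    rcases Nat.eq_zero_or_pos k with rfl | h
    · exact absurd hk (by simpa using n.factorial_ne_zero)
    · exact h
  -- A positive word is needed because only positive words can be decoded in `A⁺`.
  obtain ⟨w, hw⟩ := (FreeProfiniteGroup.denseRange_ofPositive (X := X)).exists_mem_open
    ((hχo y).inter ((isOpen_level_eq c ((θ y).1 c)).preimage hcont)) ⟨y, rfl, rfl⟩
  have hw1 : χ (ofPositive w) = χ y := hw.1
  have hw2 : (θ (ofPositive w)).1 c = (θ y).1 c := hw.2
  have hχw : ∀ v : FreeSemigroup X,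
      χ (ofPositive (ψ^[n.factorial] v)) = χ (ofPositive v) := by
    intro v
    rw [← FreeProfiniteGroup.iterate_map_ofPositive]
    induction v using FreeSemigroup.recOnMul with
    | ih1 x => exact hn x
    | ih2 x v hx hv => rw [map_mul, iterate_map_mul, map_mul, map_mul, hx, hv]
  -- As `M` divides `n!`, the iterate `φ^{n!}` of the decoded `w` represents `φ^ω` of it, that is,
  -- `θ` of `w`, modulo `c`.
  have hdec : (decode X (ψ^[n.factorial] w) : c.1.Quotient) = (θ 1).1 c := by
    rw [hψ.decode_iterate, ← hy, ← hw2, hom_ofPositive hmul hgen, hω k hk0, mul_comm, ← hk,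
      iterate_map_ofWord]
    rfl
  -- `θ 1` is idempotent, so `c` does not distinguish the decoded word from its square; hence `χ`
  -- does not either, and an idempotent of a group is trivial.
  have hsq := hc (ψ^[n.factorial] w * ψ^[n.factorial] w) (ψ^[n.factorial] w) (by
    rw [map_mul, Con.coe_mul, hdec, ← mul_apply, ← hmul, one_mul])
  rw [hlift, hlift, map_mul, map_mul, hχw, hw1] at hsq
  exact hyU ((QuotientGroup.eq_one_iff y).1 (mul_eq_left.1 hsq))

end Kernel

end Substitution

/-! ### The isomorphism from the presented group onto `G(φ)` -/

theorem theoremt {A : Type u} [Finite A] (φ : Substitution A)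
    (hprim : φ.IsWeaklyPrimitive) (a b : A)
    (hfirst : ∀ c : A, IsPrefixOf (FreeSemigroup.of a) (φ (FreeSemigroup.of c)))
    (hlast : ∀ c : A, IsSuffixOf (FreeSemigroup.of b) (φ (FreeSemigroup.of c)))
    (henc : φ.IsEncodingOfBoundedDelay) :
    (φ.returnGenerators a b).Finite ∧
    (∃! ψ : Substitution (φ.returnGenerators a b), φ.IsInducedBy ψ) ∧
    ∀ ψ : Substitution (φ.returnGenerators a b), φ.IsInducedBy ψ →
      ∃ e : PresentedProfiniteGroup ψ.omegaRelators →ₙ* FreeProfiniteSemigroup A,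
        IsEmbedding e ∧
        Set.range e = φ.schutzenbergerGroup a b ∧
        ∀ x : φ.returnGenerators a b,
          e (QuotientGroup.mk (FreeProfiniteGroup.gen x)) =
            φ.omega (FreeProfiniteSemigroup.ofWord (x : FreeSemigroup A)) := by
  have hφ : Substitution.IsProper φ a b := ⟨hprim, hfirst, hlast⟩
  have hfin := Substitution.finite_returnGenerators hprim hfirst hlast
  refine ⟨hfin, Substitution.existsUnique_isInducedBy hprim hfirst hlast, fun ψ hψ => ?_⟩
  have : Finite (φ.returnGenerators a b) := hfin
  have : Nonempty (φ.returnGenerators a b) :=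
    Substitution.nonempty_returnGenerators hprim hfirst hlast
  obtain ⟨e, he, -, hone, hinv⟩ := hφ.exists_group_one
  obtain ⟨θ, hcont, hmul, hgen, hθ⟩ := FreeProfiniteGroup.exists_hom hφ.isClosed_group
    (fun s hs t ht => hφ.mul_mem_group hs ht) he (fun s hs => (hone s hs).1) hinv
    (fun x : φ.returnGenerators a b =>
      φ.omega (FreeProfiniteSemigroup.ofWord (x : FreeSemigroup A)))
    (fun x => hφ.omega_mem_group (Substitution.returnGenerators_subset_language x.2))
  have hcompat : ∀ y z : FreeProfiniteGroup (φ.returnGenerators a b),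
      y⁻¹ * z ∈ (Subgroup.normalClosure ψ.omegaRelators).topologicalClosure ↔ θ y = θ z := by
    intro y z
    constructor
    · intro h
      calc θ y = θ (y * 1) := by rw [mul_one]
        _ = θ (y * (y⁻¹ * z)) := by
          rw [hmul, hmul, Substitution.hom_eq_of_mem_relations hcont hmul hgen hψ h]
        _ = θ z := by rw [mul_inv_cancel_left]
    · intro h
      refine Substitution.mem_relations_of_hom_eq
        (fun x hx => Substitution.isBlock_of_mem hx) hfin hcont hmul hgen hψ ?_
      rw [hmul, ← h, ← hmul, inv_mul_cancel]
  let E : PresentedProfiniteGroup ψ.omegaRelators →ₙ* FreeProfiniteSemigroup A :=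
    { toFun := fun q => Quotient.liftOn' q θ fun y z h =>
        (hcompat y z).1 (QuotientGroup.leftRel_apply.1 h)
      map_mul' := by
        intro p q
        induction p using QuotientGroup.induction_on with | H y =>
        induction q using QuotientGroup.induction_on with | H z =>
        exact hmul y z }
  have hE : ∀ y : FreeProfiniteGroup (φ.returnGenerators a b),
      E (QuotientGroup.mk y) = θ y := fun y => rfl
  refine ⟨E, ?_, ?_, fun x => (hE _).trans (hgen x)⟩
  · have hEc : Continuous E := hcont.quotient_lift _
    -- A continuous injection from a compact space to a Hausdorff space is an embedding.
    refine (hEc.isClosedEmbedding fun p q h => ?_).isEmbedding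
    induction p using QuotientGroup.induction_on with | H y =>
    induction q using QuotientGroup.induction_on with | H z =>
    exact QuotientGroup.eq.2 ((hcompat y z).2 h)
  · have hrange : Set.range E = Set.range θ := by
      ext s
      constructor
      · rintro ⟨q, rfl⟩
        induction q using QuotientGroup.induction_on with | H y =>
        exact ⟨y, rfl⟩
      · rintro ⟨y, rfl⟩
        exact ⟨QuotientGroup.mk y, rfl⟩
    rw [hrange]
    refine Set.Subset.antisymm (Set.range_subset_iff.2 hθ) fun g hg => ?_
    -- The range is compact, hence closed, so approximating `g` in each finite quotient is enough.
    rw [← (isCompact_range hcont).isClosed.closure_eq, FreeProfiniteSemigroup.mem_closure_iff_level]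
    intro c
    obtain ⟨v, hv⟩ := hφ.exists_decode_approx henc hg c
    exact ⟨_, ⟨FreeProfiniteGroup.ofPositive v, rfl⟩, by
      rw [Substitution.hom_ofPositive hmul hgen, hv]⟩
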